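/- Let $k\ge 2$, $n\ge k$ and $m\ge 0$ be integers and let $0\le p\le 1$. The $p$-polarized random $k$-CNF $\Phi_m=\Phi_m(n,k,p)=C_1\wedge\dots\wedge C_m$ on Boolean variables $x_1,\dots,x_n$ is constructed as follows. For $1\le i\le m$ and $1\le j\le k$ take independent random objects $K_i$, $B_i$, $P_{ij}$, where $K_i=(v_{i1},\dots,v_{ik})$ is uniformly distributed over the $k$-tuples of distinct indices in $\{1,\dots,n\}$, $\Pr(B_i=1)=\Pr(B_i=-1)=\tfrac12$, and $\Pr(P_{ij}=1)=p$, $\Pr(P_{ij}=-1)=1-p$. Let $z_{ij}=x_{v_{ij}}$ if $B_iP_{ij}=1$ and $z_{ij}=\neg x_{v_{ij}}$ otherwise, and let $C_i=z_{i1}\vee\dots\vee z_{ik}$. Write $\Phi_m\in\mathrm{SAT}$ if some truth assignment satisfies all clauses of $\Phi_m$, and for $-\tfrac12\le b\le\tfrac12$ put $$P_m(b)=\Pr\bigl(\Phi_m(n,k,\tfrac12-b)\in\mathrm{SAT}\bigr).$$ **Proposition.** For every integer $k\ge 2$ there is a real constant $c=c(k)\ge k$ such that for all integers $n>c$ and $m\geq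 0$ with $m/n\in[\tfrac12,2^k]$ and all $b\in[0,\tfrac12]$, the function $P_m$ is differentiable at $b$ (from the left if $b=\tfrac12$) and $$P_m'(b)\le c\,n^{-\frac{k-1}{2k}}.$$ -/

import Mathlib

open MeasureTheory ProbabilityTheory

namespace PolarizedSAT

/-- Truth assignments to the Boolean variables `x_1, …, x_n`; the value `1` is TRUE and the value
`-1` is FALSE. -/
abbrev Assignment (n : ℕ) : Type := Fin n → ℤˣ

/-- A literal on one of `n` variables: `(v, 1)` is the pure literal `x_v` and `(v, -1)` is the
negated literal `¬ x_v`. -/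
abbrev Literal (n : ℕ) : Type := Fin n × ℤˣ

/-- The literal `z` is TRUE under the assignment `σ`. -/
def Literal.Holds {n : ℕ} (z : Literal n) (σ : Assignment n) : Prop := σ z.1 = z.2

/-- A `k`-clause `z_1 ∨ … ∨ z_k`, given by its literals. -/
abbrev Clause (n k : ℕ) : Type := Fin k → Literal n

/-- The assignment `σ` satisfies the clause `C`. -/
def Clause.Holds {n k : ℕ} (C : Clause n k) (σ : Assignment n) : Prop := ∃ j, (C j).Holds σ

/-- A `k`-CNF `C_1 ∧ … ∧ C_m`, given by its clauses. -/
abbrev Formula (n k m : ℕ) : Type := Fin m → Clause n k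

/-- The formula `F` belongs to `SAT`: some assignment satisfies all of its clauses. -/
def Formula.Satisfiable {n k m : ℕ} (F : Formula n k m) : Prop :=
  ∃ σ : Assignment n, ∀ i, (F i).Holds σ

/-- The random data `(K, B, (P_1, …, P_k))` behind one random clause: the tuple of indices of its
variables, the sign of the clause, and the signs of the individual positions. -/
abbrev ClauseData (n k : ℕ) : Type := (Fin k → Fin n) × ℤˣ × (Fin k → ℤˣ)

/-- The clause built from `(K, B, (P_1, …, P_k))`: its `j`-th literal is `x_{K_j}` if `B P_j = 1`
and `¬ x_{K_j}` otherwise. -/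
def ClauseData.toClause {n k : ℕ} (d : ClauseData n k) : Clause n k :=
  fun j => (d.1 j, d.2.1 * d.2.2 j)

/-- Every set of signs is measurable. -/
instance instDiscreteSign : DiscreteMeasurableSpace ℤˣ :=
  ⟨fun s => ⟨Units.val '' s, MeasurableSet.of_discrete,
    Set.preimage_image_eq s Units.val_injective⟩⟩

/-- For `0 ≤ p ≤ 1`, the law of a random sign that is `1` with probability `p` and `-1` with
probability `1 - p`. -/
noncomputable def signLaw (p : ℝ) : Measure ℤˣ :=
  ENNReal.ofReal p • Measure.dirac 1 + ENNReal.ofReal (1 - p) • Measure.dirac (-1)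

/-- The law of the data of one `p`-polarized random clause: `K` is uniform among the `k`-tuples of
distinct indices, `B` is a fair sign, each `P_j` is `1` with probability `p`, and all of these are
independent. -/
noncomputable def clauseLaw (n k : ℕ) (p : ℝ) : Measure (ClauseData n k) :=
  (uniformOn {K : Fin k → Fin n | Function.Injective K}).prod
    ((signLaw (1 / 2)).prod (Measure.pi fun _ : Fin k => signLaw p))

/-- The law of the data of `m` independent `p`-polarized random clauses. -/
noncomputable def formulaLaw (n k m : ℕ) (p : ℝ) : Measure (Fin m → ClauseData n k) :=
  Measure.pi fun _ : Fin m => clauseLaw n k p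

/-- `P_m(b)`, the probability that the random `k`-CNF with `m` clauses on `n` variables and with
polarization `p = 1/2 - b` is satisfiable. Meaningful for `-1/2 ≤ b ≤ 1/2`, that is, for
`0 ≤ p ≤ 1`. -/
noncomputable def satProb (n k m : ℕ) (b : ℝ) : ℝ :=
  (formulaLaw n k m (1 / 2 - b)).real
    {d | Formula.Satisfiable fun i : Fin m => (d i).toClause}

end PolarizedSAT

/-! The probability is a polynomial in `b`, so it can be differentiated one clause at a time, as in
Russo's formula (`hasDerivAt_expect`). Fix the other clauses `F`, assumed satisfiable. A new clause
destroys satisfiability exactly when each of its literals is false in every solution of `F`, so all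
its variables are frozen. Let `s` be the number of frozen variables and `d` the sum of their signs.
Up to normalisation by `n ^ k`, the new clause is fatal with probability `(s/2 + b d)^k + (s/2 - b
d)^k`, with an error `O(s^(k-1))` from tuples that repeat a variable (`sum_weight_satInd_insertNth`,
`injSum_eq`).

For `b ≥ 0` the main term is nondecreasing in `b`, so only the error can make the probability of
satisfiability grow (`exists_hasDerivAt_injSum`). With `m = O(n)` clauses the derivative is thus at
most a constant times the mean of `(s/n)^(k-1)` over satisfiable formulas.

By convexity the main term is at least `s^k / 2^(k-1)`. Hence the mean of `(s/n)^k` is bounded by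
the loss of satisfiability caused by one extra clause, plus `O(n^(-1/2))` (`frozenMoment_le`). That
loss is itself `O(n^(-1/2))` (`expect_satInd_sub_succ_le`): deleting an unused variable keeps the
number of clauses, deleting a variable used once also removes its clause, neither affects
satisfiability, and the numbers of such variables are concentrated within `O(√n)`. Interpolating
from the `k`-th to the `(k-1)`-th moment turns `n^(-1/2)` into `n^(-(k-1)/(2k))`
(`frozenMoment_pred_le`). -/

namespace PolarizedSAT

/-! ### Expectations of functions of independent samples from a finite weighted type -/

section Expect

variable {Γ Γ' : Type*} [Fintype Γ] [Fintype Γ'] {m : ℕ}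

/-- The expectation of `f F` where the entries of `F` are sampled independently with weights `W`. -/
noncomputable def expect (W : Γ → ℝ) (f : (Fin m → Γ) → ℝ) : ℝ := ∑ F, (∏ i, W (F i)) * f F

lemma expect_insertNth (W : Γ → ℝ) (f : (Fin (m + 1) → Γ) → ℝ) (i : Fin (m + 1)) :
    expect W f = ∑ C, W C * expect W fun F : Fin m → Γ => f (i.insertNth C F) := by
  unfold expect
  rw [← (Fin.insertNthEquiv (fun _ => Γ) i).sum_comp, Fintype.sum_prod_type]
  refine Finset.sum_congr rfl fun C _ => ?_
  rw [Finset.mul_sum]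
  refine Finset.sum_congr rfl fun F _ => ?_
  simp only [Fin.prod_univ_succAbove _ i, Fin.insertNthEquiv_apply, Fin.insertNth_apply_same,
    Fin.insertNth_apply_succAbove, mul_assoc]
  rfl

lemma expect_one {W : Γ → ℝ} (hW : ∑ C, W C = 1) : expect W (fun _ : Fin m → Γ => 1) = 1 := by
  simp only [expect, mul_one]
  rw [← Fintype.sum_pow, hW, one_pow]

lemma expect_add (W : Γ → ℝ) (f g : (Fin m → Γ) → ℝ) :
    expect W (fun F => f F + g F) = expect W f + expect W g := by
  simp [expect, mul_add, Finset.sum_add_distrib]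

lemma expect_sub (W : Γ → ℝ) (f g : (Fin m → Γ) → ℝ) :
    expect W (fun F => f F - g F) = expect W f - expect W g := by
  simp [expect, mul_sub, Finset.sum_sub_distrib]

lemma expect_mul_left (W : Γ → ℝ) (c : ℝ) (f : (Fin m → Γ) → ℝ) :
    expect W (fun F => c * f F) = c * expect W f := by
  simp only [expect, Finset.mul_sum]
  exact Finset.sum_congr rfl fun F _ => by ring

lemma expect_const {W : Γ → ℝ} (hW : ∑ C, W C = 1) (c : ℝ) :
    expect W (fun _ : Fin m → Γ => c) = c := by
  simpa [expect_one hW] using expect_mul_left W c fun _ : Fin m → Γ => 1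

lemma expect_sum {ι : Type*} (s : Finset ι) (W : Γ → ℝ) (f : ι → (Fin m → Γ) → ℝ) :
    expect W (fun F => ∑ v ∈ s, f v F) = ∑ v ∈ s, expect W (f v) := by
  simp only [expect, Finset.mul_sum]
  exact Finset.sum_comm

lemma expect_mono {W : Γ → ℝ} (hW : ∀ C, 0 ≤ W C) {f g : (Fin m → Γ) → ℝ}
    (h : ∀ F, f F ≤ g F) : expect W f ≤ expect W g :=
  Finset.sum_le_sum fun F _ =>
    mul_le_mul_of_nonneg_left (h F) (Finset.prod_nonneg fun _ _ => hW _)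

lemma expect_nonneg {W : Γ → ℝ} (hW : ∀ C, 0 ≤ W C) {f : (Fin m → Γ) → ℝ}
    (h : ∀ F, 0 ≤ f F) : 0 ≤ expect W f :=
  Finset.sum_nonneg fun F _ => mul_nonneg (Finset.prod_nonneg fun _ _ => hW _) (h F)

/-- If restricting `W` to the support of `av` gives `a` times the pushforward of `W'` by `φ`, then
the same holds for independent samples. -/
lemma expect_restrict {W : Γ → ℝ} {W' : Γ' → ℝ} {av : Γ → ℝ} {φ : Γ' → Γ} {a : ℝ}
    (h : ∀ g : Γ → ℝ, ∑ C, W C * (av C * g C) = a * ∑ C, W' C * g (φ C))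
    (f : (Fin m → Γ) → ℝ) :
    expect W (fun F => (∏ i, av (F i)) * f F) = a ^ m * expect W' fun F => f (φ ∘ F) := by
  induction m with
  | zero =>
    simp only [expect, Finset.univ_unique, Finset.sum_singleton, Finset.univ_eq_empty,
      Finset.prod_empty, one_mul, pow_zero]
    exact congrArg f (Subsingleton.elim _ _)
  | succ m ih =>
    rw [expect_insertNth _ _ 0, expect_insertNth _ _ 0]
    have h1 : ∀ C, expect W (fun F : Fin m → Γ =>
        (∏ i, av ((Fin.insertNth 0 C F : Fin (m + 1) → Γ) i)) *
        f (Fin.insertNth 0 C F)) =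
        av C * (a ^ m * expect W' fun F => f (Fin.insertNth 0 C (φ ∘ F))) := by
      intro C
      rw [← ih fun F => f (Fin.insertNth 0 C F), ← expect_mul_left]
      refine congrArg _ (funext fun F => ?_)
      simp [Fin.prod_univ_succ, mul_assoc]
    simp only [h1]
    rw [h fun C => a ^ m * expect W' fun F => f (Fin.insertNth 0 C (φ ∘ F)), pow_succ',
      Finset.mul_sum, Finset.mul_sum]
    refine Finset.sum_congr rfl fun C _ => ?_
    have h2 : ∀ F : Fin m → Γ', φ ∘ (Fin.insertNth 0 C F : Fin (m + 1) → Γ') =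
        (Fin.insertNth 0 (φ C) (φ ∘ F) : Fin (m + 1) → Γ) := by
      intro F
      ext i
      refine Fin.cases ?_ (fun j => ?_) i <;> simp
    simp only [h2]
    ring

/-- Second moment bound for a sum of indicator-like functions whose pairwise correlations are
small. -/
lemma abs_sum_expect_sub_le {N : ℕ} {W : Γ → ℝ} (hW : ∀ C, 0 ≤ W C) (hW1 : ∑ C, W C = 1)
    (A : Fin N → (Fin m → Γ) → ℝ) (hA0 : ∀ v F, 0 ≤ A v F) (hA1 : ∀ v F, A v F ≤ 1) {p c : ℝ}
    (hc : 0 ≤ c) (hp : ∀ v, expect W (A v) = p)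
    (hpair : ∀ v w, v ≠ w → expect W (fun F => A w F * A v F) ≤ p ^ 2 + c / N)
    {f : (Fin m → Γ) → ℝ} (hf0 : ∀ F, 0 ≤ f F) (hf1 : ∀ F, f F ≤ 1) :
    |∑ v, expect W (fun F => A v F * f F) - N * p * expect W f| ≤ (c + 2) * √N := by
  rcases Nat.eq_zero_or_pos N with rfl | hN
  · simp
  have hN' : (0 : ℝ) < N := by exact_mod_cast hN
  set Y : (Fin m → Γ) → ℝ := fun F => ∑ v, A v F - N * p with hY
  have hYf : ∑ v, expect W (fun F => A v F * f F) - N * p * expect W f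
      = expect W fun F => Y F * f F := by
    rw [← expect_sum, ← expect_mul_left, ← expect_sub]
    refine congrArg _ (funext fun F => ?_)
    simp [hY, sub_mul, Finset.sum_mul]
  have hY2 : expect W (fun F => Y F ^ 2) ≤ (c + 1) * N := by
    have e1 : expect W (fun F => Y F ^ 2) =
        ∑ v, ∑ w, expect W (fun F => A w F * A v F) - N ^ 2 * p ^ 2 := by
      have : ∀ F, Y F ^ 2 = ∑ v, ∑ w, A w F * A v F - (2 * N * p * ∑ v, A v F - N ^ 2 * p ^ 2) := by
        intro F
        have : ∑ v, ∑ w, A w F * A v F = (∑ v, A v F) ^ 2 := by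
          rw [sq, Finset.sum_mul_sum]
          exact Finset.sum_congr rfl fun v _ => Finset.sum_congr rfl fun w _ => mul_comm _ _
        rw [this, hY]
        ring
      simp only [this]
      rw [expect_sub, expect_sub, expect_mul_left, expect_sum, expect_sum, expect_const hW1]
      simp only [expect_sum, hp, Finset.sum_const, Finset.card_univ, Fintype.card_fin, nsmul_eq_mul]
      ring
    -- Diagonal terms are only bounded by 1: they cost `N` in total, the same order as the `N ^ 2`
    -- errors `c / N`.
    have e2 : ∀ v w,
        expect W (fun F => A w F * A v F) ≤ p ^ 2 + c / N + if v = w then 1 else 0 := by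
      intro v w
      by_cases hvw : v = w
      · have : expect W (fun F => A w F * A v F) ≤ 1 := by
          rw [← expect_one (m := m) hW1]
          exact expect_mono hW fun F => mul_le_one₀ (hA1 _ _) (hA0 _ _) (hA1 _ _)
        simp only [hvw, if_true] at this ⊢
        have : 0 ≤ c / N := by positivity
        nlinarith [sq_nonneg p]
      · simpa [hvw] using hpair v w hvw
    have e3 : ∑ v, ∑ w, expect W (fun F => A w F * A v F) ≤ N ^ 2 * p ^ 2 + c * N + N := by
      calc _ ≤ ∑ v : Fin N, ∑ w : Fin N, (p ^ 2 + c / N + if v = w then 1 else 0) :=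
            Finset.sum_le_sum fun v _ => Finset.sum_le_sum fun w _ => e2 v w
        _ = _ := by
            simp [Finset.sum_add_distrib]
            field_simp
    linarith
  have hs : 0 < √(N : ℝ) := Real.sqrt_pos.2 hN'
  have hss : √(N : ℝ) * √N = N := Real.mul_self_sqrt hN'.le
  have hmean : (√(N : ℝ))⁻¹ * expect W (fun F => Y F ^ 2) ≤ (c + 1) * √N := by
    rw [inv_mul_le_iff₀ hs]
    nlinarith
  -- This pointwise bound plays the role of Cauchy–Schwarz: a second moment `O(N)` of `Y` gives a
  -- first absolute moment `O(√N)`.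
  have hpt : ∀ F, |Y F * f F| ≤ √N + (√(N : ℝ))⁻¹ * Y F ^ 2 := by
    intro F
    have h1 : |Y F * f F| ≤ |Y F| := by
      rw [abs_mul, abs_of_nonneg (hf0 F)]
      exact mul_le_of_le_one_right (abs_nonneg _) (hf1 F)
    refine h1.trans ?_
    rw [← sq_abs (Y F)]
    have h2 : √(N : ℝ) * (√N + (√(N : ℝ))⁻¹ * |Y F| ^ 2) = √N ^ 2 + |Y F| ^ 2 := by
      field_simp
    refine le_of_mul_le_mul_left ?_ hs
    rw [h2]
    nlinarith [sq_nonneg (√(N : ℝ) - |Y F|), mul_nonneg hs.le (abs_nonneg (Y F))]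
  rw [hYf, abs_le]
  have h3 : expect W (fun F => √N + (√(N : ℝ))⁻¹ * Y F ^ 2) ≤ (c + 2) * √N := by
    rw [expect_add, expect_const hW1, expect_mul_left]
    linarith
  constructor
  · have : expect W (fun F => (-1) * (√N + (√(N : ℝ))⁻¹ * Y F ^ 2)) ≤ expect W fun F => Y F * f F :=
      expect_mono hW fun F => by linarith [neg_abs_le (Y F * f F), hpt F]
    rw [expect_mul_left] at this
    linarith
  · exact (expect_mono hW fun F => (le_abs_self _).trans (hpt F)).trans h3

end Expect

/-! ### The weight of a random clause -/

/-- The probability of the clause data `d` at polarization `1 / 2 - b`. -/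
noncomputable def weight (n k : ℕ) (b : ℝ) (d : ClauseData n k) : ℝ :=
  (if Function.Injective d.1 then ((n.descFactorial k : ℕ) : ℝ)⁻¹ else 0) *
    (1 / 2 * ∏ j, (1 / 2 - ((d.2.2 j : ℤ) : ℝ) * b))

lemma sum_sign (f : ℤˣ → ℝ) : ∑ s, f s = f 1 + f (-1) := by
  simp [UnitsInt.univ]

lemma weight_nonneg {n k : ℕ} {b : ℝ} (hb : |b| ≤ 1 / 2) (d : ClauseData n k) :
    0 ≤ weight n k b d := by
  obtain ⟨h1, h2⟩ := abs_le.1 hb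
  refine mul_nonneg (by split_ifs <;> positivity) (mul_nonneg (by norm_num)
    (Finset.prod_nonneg fun j _ => ?_))
  rcases Int.units_eq_one_or (d.2.2 j) with h | h <;> simp [h] <;> linarith

/-- Averages over clause data whose observable is a product over positions. -/
lemma sum_weight_mul_prod (n k : ℕ) (b : ℝ) (a : Fin n → ℤˣ → ℝ) :
    ∑ d : ClauseData n k, weight n k b d * ∏ j, a (d.1 j) (d.2.1 * d.2.2 j) =
      ((n.descFactorial k : ℕ) : ℝ)⁻¹ * (1 / 2) *
        ∑ K : Fin k → Fin n, if Function.Injective K then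
          ∏ j, ((1 / 2 - b) * a (K j) 1 + (1 / 2 + b) * a (K j) (-1)) +
          ∏ j, ((1 / 2 - b) * a (K j) (-1) + (1 / 2 + b) * a (K j) 1) else 0 := by
  rw [Fintype.sum_prod_type, Finset.mul_sum]
  refine Finset.sum_congr rfl fun K _ => ?_
  rw [Fintype.sum_prod_type]
  have h : ∀ B : ℤˣ, ∑ P : Fin k → ℤˣ, weight n k b (K, B, P) * ∏ j, a (K j) (B * P j) =
      (if Function.Injective K then ((n.descFactorial k : ℕ) : ℝ)⁻¹ else 0) * (1 / 2) *
        ∏ j, ((1 / 2 - b) * a (K j) B + (1 / 2 + b) * a (K j) (-B)) := by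
    intro B
    have : ∀ j, (1 / 2 - b) * a (K j) B + (1 / 2 + b) * a (K j) (-B) =
        ∑ s : ℤˣ, (1 / 2 - ((s : ℤ) : ℝ) * b) * a (K j) (B * s) := by
      intro j
      rw [sum_sign]
      simp
    simp only [this]
    rw [Finset.prod_univ_sum, Fintype.piFinset_univ, Finset.mul_sum]
    refine Finset.sum_congr rfl fun P _ => ?_
    simp only [weight, Finset.prod_mul_distrib]
    ring
  simp only [h, sum_sign, neg_neg]
  split_ifs <;> ring

lemma card_injective (n k : ℕ) :
    (Finset.univ.filter fun K : Fin k → Fin n => Function.Injective K).card =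
      n.descFactorial k := by
  rw [← Fintype.card_subtype, Fintype.card_congr (Equiv.subtypeInjectiveEquivEmbedding _ _),
    Fintype.card_embedding_eq]
  simp

lemma sum_weight {n k : ℕ} (hk : k ≤ n) (b : ℝ) : ∑ d, weight n k b d = 1 := by
  have h := sum_weight_mul_prod n k b fun _ _ => 1
  simp only [Finset.prod_const_one, mul_one] at h
  rw [h]
  have h2 : (1 / 2 - b + (1 / 2 + b)) = 1 := by ring
  have h3 : ((n.descFactorial k : ℕ) : ℝ) ≠ 0 := by
    exact_mod_cast (Nat.descFactorial_pos.2 hk).ne'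
  simp only [h2, Finset.prod_const_one]
  rw [← Finset.sum_filter, Finset.sum_const, card_injective, nsmul_eq_mul]
  field_simp
  norm_num

/-- The indicator that the clause does not involve the variable `v`. -/
noncomputable def avoids {n k : ℕ} (v : Fin n) (d : ClauseData n k) : ℝ :=
  if ∀ j, d.1 j ≠ v then 1 else 0

/-- Reindexing the variables so that `v` is not used. -/
def skip {n k : ℕ} (v : Fin (n + 1)) (d : ClauseData n k) : ClauseData (n + 1) k :=
  (v.succAbove ∘ d.1, d.2)

lemma avoids_skip {n k : ℕ} (v : Fin (n + 1)) (w : Fin n) (d : ClauseData n k) :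
    avoids (v.succAbove w) (skip v d) = avoids w d := by
  simp [avoids, skip]

lemma avoids_nonneg {n k : ℕ} (v : Fin n) (d : ClauseData n k) : 0 ≤ avoids v d := by
  unfold avoids; split_ifs <;> norm_num

lemma avoids_le_one {n k : ℕ} (v : Fin n) (d : ClauseData n k) : avoids v d ≤ 1 := by
  unfold avoids; split_ifs <;> norm_num

lemma avoids_eq {n k : ℕ} (v : Fin n) (d : ClauseData n k) : avoids v d = 0 ∨ avoids v d = 1 := by
  unfold avoids; split_ifs <;> simp

/-- The probability that a random clause on `n + 1` variables avoids a given variable. -/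
noncomputable def avoidProb (n k : ℕ) : ℝ := 1 - k / (n + 1)

/-- Conditioned on avoiding `v`, a random clause is a random clause on the other `n` variables. All
deletions of variables rest on this. -/
lemma sum_weight_avoids_mul {n k : ℕ} (hk : k ≤ n) (b : ℝ) (v : Fin (n + 1))
    (g : ClauseData (n + 1) k → ℝ) :
    ∑ d, weight (n + 1) k b d * (avoids v d * g d) =
      avoidProb n k * ∑ d, weight n k b d * g (skip v d) := by
  have h0 : (n.descFactorial k : ℝ) ≠ 0 := by exact_mod_cast (Nat.descFactorial_pos.2 hk).ne'
  have h0' : ((n + 1).descFactorial k : ℝ) ≠ 0 := by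
    exact_mod_cast (Nat.descFactorial_pos.2 (hk.trans n.le_succ)).ne'
  have hN : (((n + 1).descFactorial k : ℕ) : ℝ)⁻¹ =
      avoidProb n k * ((n.descFactorial k : ℕ) : ℝ)⁻¹ := by
    have := Nat.succ_descFactorial n k
    have h2 : ((n : ℝ) + 1 - k) * ((n + 1).descFactorial k : ℝ) = (n + 1) * n.descFactorial k := by
      have h3 : ((n + 1 - k : ℕ) : ℝ) = (n : ℝ) + 1 - k := by
        rw [Nat.cast_sub (by omega)]; push_cast; ring
      rw [← h3]
      exact_mod_cast this
    have h4 : (n : ℝ) + 1 ≠ 0 := by positivity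
    unfold avoidProb
    field_simp
    linarith
  rw [Finset.mul_sum, Fintype.sum_prod_type, Fintype.sum_prod_type]
  have himg : (Finset.univ.filter fun K : Fin k → Fin (n + 1) => ∀ j, K j ≠ v) =
      Finset.univ.image fun K : Fin k → Fin n => v.succAbove ∘ K := by
    ext K
    simp only [Finset.mem_filter, Finset.mem_univ, true_and, Finset.mem_image]
    constructor
    · intro h
      choose K' hK' using fun j => Fin.exists_succAbove_eq (h j)
      exact ⟨K', funext hK'⟩
    · rintro ⟨K', rfl⟩ j
      exact Fin.succAbove_ne _ _
  have hsum : ∀ h : (Fin k → Fin (n + 1)) → ℝ,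
      ∑ K, (if ∀ j, K j ≠ v then h K else 0) = ∑ K : Fin k → Fin n, h (v.succAbove ∘ K) := by
    intro h
    rw [← Finset.sum_filter, himg, Finset.sum_image]
    exact fun K _ K' _ hK => (Fin.succAbove_right_injective (p := v)).comp_left hK
  have e1 : ∀ K : Fin k → Fin (n + 1), ∑ y : ℤˣ × (Fin k → ℤˣ),
      weight (n + 1) k b (K, y) * (avoids v (K, y) * g (K, y)) =
      if ∀ j, K j ≠ v then ∑ y, weight (n + 1) k b (K, y) * g (K, y) else 0 := by
    intro K
    simp only [avoids]
    split_ifs <;> simp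
  simp only [e1]
  rw [hsum]
  refine Finset.sum_congr rfl fun K _ => Finset.sum_congr rfl fun y _ => ?_
  have hinj : Function.Injective (v.succAbove ∘ K) ↔ Function.Injective K :=
    (Fin.succAbove_right_injective (p := v)).of_comp_iff K
  simp only [weight, hinj, skip, hN]
  split_ifs <;> ring

lemma sum_weight_avoids {n k : ℕ} (hk : k ≤ n) (b : ℝ) (v : Fin (n + 1)) :
    ∑ d, weight (n + 1) k b d * avoids v d = avoidProb n k := by
  simpa [sum_weight hk] using sum_weight_avoids_mul hk b v fun _ => 1

/-! ### Satisfiability -/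

open Classical in
/-- The indicator that the formula with the given data is satisfiable. -/
noncomputable def satInd {n k m : ℕ} (F : Fin m → ClauseData n k) : ℝ :=
  if Formula.Satisfiable fun i => (F i).toClause then 1 else 0

lemma satInd_nonneg {n k m : ℕ} (F : Fin m → ClauseData n k) : 0 ≤ satInd F := by
  unfold satInd; split_ifs <;> norm_num

lemma satInd_le_one {n k m : ℕ} (F : Fin m → ClauseData n k) : satInd F ≤ 1 := by
  unfold satInd; split_ifs <;> norm_num

lemma toClause_skip_holds {n k : ℕ} (v : Fin (n + 1)) (d : ClauseData n k)
    (σ : Assignment (n + 1)) :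
    (skip v d).toClause.Holds σ ↔ d.toClause.Holds (σ ∘ v.succAbove) := Iff.rfl

lemma satInd_skip {n k m : ℕ} (v : Fin (n + 1)) (F : Fin m → ClauseData n k) :
    satInd (skip v ∘ F) = satInd F := by
  have : (Formula.Satisfiable fun i => ((skip v ∘ F) i).toClause) ↔
      Formula.Satisfiable fun i => (F i).toClause := by
    constructor
    · rintro ⟨σ, h⟩
      exact ⟨σ ∘ v.succAbove, fun i => h i⟩
    · rintro ⟨σ, h⟩
      refine ⟨v.insertNth (α := fun _ => ℤˣ) 1 σ, fun i => (toClause_skip_holds v (F i) _).2 ?_⟩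
      convert h i
      ext j
      simp
  classical
  exact if_congr this rfl rfl

/-- A clause with a variable that occurs nowhere else does not affect satisfiability. -/
lemma satInd_insertNth_skip {n k m : ℕ} (v : Fin (n + 1)) (F : Fin m → ClauseData n k)
    {d : ClauseData (n + 1) k} (hd : avoids v d = 0) (i : Fin (m + 1)) :
    satInd (i.insertNth d (skip v ∘ F) : Fin (m + 1) → ClauseData (n + 1) k) = satInd F := by
  have hd' : ∃ j, d.1 j = v := by
    by_contra! h
    simp [avoids, h] at hd
  obtain ⟨j, hj⟩ := hd'
  have : (Formula.Satisfiable fun l =>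
      ((i.insertNth d (skip v ∘ F) : Fin (m + 1) → ClauseData (n + 1) k) l).toClause) ↔
      Formula.Satisfiable fun l => (F l).toClause := by
    constructor
    · rintro ⟨σ, h⟩
      refine ⟨σ ∘ v.succAbove, fun l => ?_⟩
      have := h (i.succAbove l)
      beta_reduce at this
      rw [Fin.insertNth_apply_succAbove] at this
      exact this
    · rintro ⟨σ, h⟩
      refine ⟨v.insertNth (α := fun _ => ℤˣ) (d.2.1 * d.2.2 j) σ, fun l => ?_⟩
      refine Fin.succAboveCases i ?_ (fun l => ?_) l
      · beta_reduce
        rw [Fin.insertNth_apply_same]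
        refine ⟨j, ?_⟩
        simp [Literal.Holds, ClauseData.toClause, hj]
      · beta_reduce
        rw [Fin.insertNth_apply_succAbove]
        refine (toClause_skip_holds v (F l) _).2 ?_
        convert h l
        ext j
        simp
  classical
  exact if_congr this rfl rfl

/-! ### Variables occurring in no clause or in exactly one clause -/

section Occurrence

variable {n k m : ℕ}

/-- The indicator that `v` occurs in no clause. -/
noncomputable def unused (v : Fin n) (F : Fin m → ClauseData n k) : ℝ := ∏ i, avoids v (F i)

/-- The indicator that `v` occurs in exactly one clause. -/
noncomputable def usedOnce (v : Fin n) (F : Fin m → ClauseData n k) : ℝ :=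
  ∑ i, ∏ j, if j = i then 1 - avoids v (F j) else avoids v (F j)

lemma unused_nonneg (v : Fin n) (F : Fin m → ClauseData n k) : 0 ≤ unused v F :=
  Finset.prod_nonneg fun _ _ => avoids_nonneg _ _

lemma unused_le_one (v : Fin n) (F : Fin m → ClauseData n k) : unused v F ≤ 1 :=
  Finset.prod_le_one (fun _ _ => avoids_nonneg _ _) fun _ _ => avoids_le_one _ _

lemma usedOnce_nonneg (v : Fin n) (F : Fin m → ClauseData n k) : 0 ≤ usedOnce v F := by
  refine Finset.sum_nonneg fun i _ => Finset.prod_nonneg fun j _ => ?_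
  split_ifs
  · linarith [avoids_le_one v (F j)]
  · exact avoids_nonneg _ _

lemma usedOnce_le_one (v : Fin n) (F : Fin m → ClauseData n k) : usedOnce v F ≤ 1 := by
  by_cases h : ∃ i, avoids v (F i) = 0
  · obtain ⟨i, hi⟩ := h
    unfold usedOnce
    rw [Finset.sum_eq_single i]
    · refine Finset.prod_le_one (fun j _ => ?_) fun j _ => ?_
      · split_ifs
        · linarith [avoids_le_one v (F j)]
        · exact avoids_nonneg _ _
      · split_ifs
        · linarith [avoids_nonneg v (F j)]
        · exact avoids_le_one _ _
    · intro l _ hl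
      refine Finset.prod_eq_zero (Finset.mem_univ i) ?_
      rw [if_neg hl.symm, hi]
    · simp
  · push Not at h
    have h1 : ∀ i, avoids v (F i) = 1 := fun i => (avoids_eq v (F i)).resolve_left (h i)
    unfold usedOnce
    rw [Finset.sum_eq_zero]
    · norm_num
    · intro i _
      exact Finset.prod_eq_zero (Finset.mem_univ i) (by simp [h1])

lemma unused_skip (v : Fin (n + 1)) (w : Fin n) (F : Fin m → ClauseData n k) :
    unused (v.succAbove w) (skip v ∘ F) = unused w F := by
  simp [unused, avoids_skip]

lemma usedOnce_skip (v : Fin (n + 1)) (w : Fin n) (F : Fin m → ClauseData n k) :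
    usedOnce (v.succAbove w) (skip v ∘ F) = usedOnce w F := by
  simp [usedOnce, avoids_skip]

lemma usedOnce_insertNth (w : Fin n) (i : Fin (m + 1)) (d : ClauseData n k)
    (F : Fin m → ClauseData n k) :
    usedOnce w (i.insertNth d F : Fin (m + 1) → ClauseData n k) =
      (1 - avoids w d) * unused w F + avoids w d * usedOnce w F := by
  unfold usedOnce unused
  rw [Fin.sum_univ_succAbove _ i, Finset.mul_sum]
  congr 1
  · rw [Fin.prod_univ_succAbove _ i]
    simp [Fin.succAbove_ne]
  · refine Finset.sum_congr rfl fun l _ => ?_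
    rw [Fin.prod_univ_succAbove _ i]
    simp [Fin.ne_succAbove]

variable (hk : k ≤ n) {b : ℝ}

include hk

lemma expect_unused_mul (v : Fin (n + 1)) (f : (Fin m → ClauseData (n + 1) k) → ℝ) :
    expect (weight (n + 1) k b) (fun F => unused v F * f F) =
      avoidProb n k ^ m * expect (weight n k b) fun F => f (skip v ∘ F) :=
  expect_restrict (sum_weight_avoids_mul hk b v) f

/-- Decomposes by the position `i` and the content `d` of the single clause containing `v`; the
other `m` clauses live on the remaining `n` variables. -/
lemma expect_usedOnce_mul (v : Fin (n + 1)) (f : (Fin (m + 1) → ClauseData (n + 1) k) → ℝ) :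
    expect (weight (n + 1) k b) (fun F => usedOnce v F * f F) =
      ∑ i : Fin (m + 1), ∑ d, weight (n + 1) k b d * ((1 - avoids v d) *
        (avoidProb n k ^ m * expect (weight n k b) fun F => f (i.insertNth d (skip v ∘ F)))) := by
  simp only [usedOnce, Finset.sum_mul]
  rw [expect_sum]
  refine Finset.sum_congr rfl fun i _ => ?_
  rw [expect_insertNth _ _ i]
  refine Finset.sum_congr rfl fun d _ => ?_
  rw [← expect_unused_mul hk v fun F => f (i.insertNth d F)]
  congr 1
  rw [← expect_mul_left]
  congr 1
  funext F
  rw [Fin.prod_univ_succAbove _ i]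
  simp [Fin.succAbove_ne, unused, mul_assoc]

lemma sum_weight_not_avoids (b : ℝ) (v : Fin (n + 1)) :
    ∑ d, weight (n + 1) k b d * (1 - avoids v d) = 1 - avoidProb n k := by
  simp only [mul_sub, mul_one, Finset.sum_sub_distrib]
  rw [sum_weight (hk.trans n.le_succ), sum_weight_avoids hk]

lemma expect_unused (v : Fin (n + 1)) :
    expect (weight (n + 1) k b) (fun F : Fin m → ClauseData (n + 1) k => unused v F) =
      avoidProb n k ^ m := by
  simpa [expect_one (sum_weight hk b)] using
    expect_unused_mul (b := b) hk v fun _ : Fin m → ClauseData (n + 1) k => 1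

lemma expect_unused_mul_satInd (v : Fin (n + 1)) :
    expect (weight (n + 1) k b) (fun F : Fin m → ClauseData (n + 1) k => unused v F * satInd F) =
      avoidProb n k ^ m * expect (weight n k b) (satInd (n := n) (k := k) (m := m)) := by
  rw [expect_unused_mul hk]
  simp only [satInd_skip]

lemma expect_usedOnce_mul_of_const (v : Fin (n + 1)) {q : ℝ}
    {f : (Fin (m + 1) → ClauseData (n + 1) k) → ℝ}
    (hf : ∀ (i : Fin (m + 1)) d, avoids v d = 0 →
      expect (weight n k b)
        (fun F : Fin m → ClauseData n k => f (i.insertNth d (skip v ∘ F))) = q) :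
    expect (weight (n + 1) k b) (fun F => usedOnce v F * f F) =
      (m + 1) * (1 - avoidProb n k) * avoidProb n k ^ m * q := by
  rw [expect_usedOnce_mul hk]
  have : ∀ (i : Fin (m + 1)) d, weight (n + 1) k b d * ((1 - avoids v d) * (avoidProb n k ^ m *
      expect (weight n k b) fun F => f (i.insertNth d (skip v ∘ F)))) =
      weight (n + 1) k b d * (1 - avoids v d) * (avoidProb n k ^ m * q) := by
    intro i d
    rcases avoids_eq v d with h | h
    · rw [hf i d h]; ring
    · simp [h]
  simp only [this, ← Finset.sum_mul, sum_weight_not_avoids hk]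
  simp
  ring

lemma expect_usedOnce_succ (v : Fin (n + 1)) :
    expect (weight (n + 1) k b) (fun F : Fin (m + 1) → ClauseData (n + 1) k => usedOnce v F) =
      (m + 1) * (1 - avoidProb n k) * avoidProb n k ^ m := by
  have := expect_usedOnce_mul_of_const (b := b) (m := m) hk v (f := fun _ => 1) (q := 1)
    fun _ _ _ => expect_one (sum_weight hk b)
  simpa using this

/-- The clause containing `v` can be satisfied through `v` alone, so it disappears together with
`v`. This is how formulas with `m` clauses enter the comparison with `m + 1`. -/
lemma expect_usedOnce_mul_satInd (v : Fin (n + 1)) :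
    expect (weight (n + 1) k b)
        (fun F : Fin (m + 1) → ClauseData (n + 1) k => usedOnce v F * satInd F) =
      (m + 1) * (1 - avoidProb n k) * avoidProb n k ^ m *
        expect (weight n k b) (satInd (n := n) (k := k) (m := m)) := by
  refine expect_usedOnce_mul_of_const hk v fun i d hd => ?_
  congr 1
  funext F
  exact satInd_insertNth_skip v F hd i

lemma avoidProb_nonneg : 0 ≤ avoidProb n k := by
  unfold avoidProb
  have : (k : ℝ) / (n + 1) ≤ 1 := by
    rw [div_le_one (by positivity)]
    have : (k : ℝ) ≤ n := by exact_mod_cast hk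
    linarith
  linarith

omit hk in
lemma avoidProb_le_one : avoidProb n k ≤ 1 := by
  unfold avoidProb
  have : 0 ≤ (k : ℝ) / (n + 1) := by positivity
  linarith

omit hk in
lemma avoidProb_le_succ : avoidProb n k ≤ avoidProb (n + 1) k := by
  unfold avoidProb
  have : (k : ℝ) / ((n + 1 : ℕ) + 1) ≤ k / (n + 1) := by
    gcongr
    simp
  linarith

/-- Negative correlation: avoiding a second variable is less likely once one variable has been
removed (`avoidProb_le_succ`). -/
lemma expect_unused_mul_unused {v w : Fin (n + 2)} (hvw : v ≠ w) :
    expect (weight (n + 2) k b)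
        (fun F : Fin m → ClauseData (n + 2) k => unused w F * unused v F) ≤
      (avoidProb (n + 1) k ^ m) ^ 2 := by
  obtain ⟨w, rfl⟩ := Fin.exists_succAbove_eq hvw.symm
  simp only [mul_comm (unused (v.succAbove w) _)]
  rw [expect_unused_mul (hk.trans n.le_succ)]
  simp only [unused_skip]
  rw [expect_unused hk, sq]
  have h1 := avoidProb_nonneg hk
  have h2 := avoidProb_le_succ (n := n) (k := k)
  have h3 : 0 ≤ avoidProb (n + 1) k := h1.trans h2
  gcongr

/-- By inclusion–exclusion the sum is `1 - 2a + a a'` with `a = avoidProb (n + 1) k` and `a' =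
avoidProb n k ≤ a`. -/
lemma sum_weight_not_avoids_mul {v : Fin (n + 2)} {w : Fin (n + 1)} (b : ℝ) :
    ∑ d, weight (n + 2) k b d * ((1 - avoids v d) * (1 - avoids (v.succAbove w) d)) ≤
      (1 - avoidProb (n + 1) k) ^ 2 := by
  have hk1 := hk.trans n.le_succ
  have e : ∀ d, weight (n + 2) k b d * ((1 - avoids v d) * (1 - avoids (v.succAbove w) d)) =
      weight (n + 2) k b d * (1 - avoids v d) - weight (n + 2) k b d * avoids (v.succAbove w) d
        + weight (n + 2) k b d * (avoids v d * avoids (v.succAbove w) d) := fun d => by ring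
  simp only [e, Finset.sum_add_distrib, Finset.sum_sub_distrib]
  rw [sum_weight_not_avoids hk1, sum_weight_avoids hk1, sum_weight_avoids_mul hk1]
  simp only [avoids_skip]
  rw [sum_weight_avoids hk]
  nlinarith [avoidProb_nonneg hk, avoidProb_le_succ (n := n) (k := k)]

/-- The main term on the right is the same probability for `m + 1` clauses on `n + 2` variables:
removing one clause and one variable raises it by at most `O(1/n)`. Needed for the correlation of
two variables. -/
lemma expect_usedOnce_le (hm : 1 ≤ k) {μ : ℝ} (hμ : (m : ℝ) + 1 ≤ μ * (n + 2)) (v : Fin (n + 1)) :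
    expect (weight (n + 1) k b) (fun F : Fin m → ClauseData (n + 1) k => usedOnce v F) ≤
      (m + 1) * (1 - avoidProb (n + 1) k) * avoidProb (n + 1) k ^ m + 3 * μ * k ^ 2 / (n + 2) := by
  have h1 := avoidProb_nonneg hk
  have h2 := avoidProb_le_succ (n := n) (k := k)
  have h3 : avoidProb (n + 1) k ≤ 1 := avoidProb_le_one
  have h4 := h1.trans h2
  have hn2 : (0 : ℝ) < n + 2 := by positivity
  have hμ0 : 0 ≤ μ := by
    by_contra! h
    nlinarith [(Nat.cast_nonneg m : (0 : ℝ) ≤ m)]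
  rcases m with _ | m
  · have : expect (weight (n + 1) k b)
        (fun F : Fin 0 → ClauseData (n + 1) k => usedOnce v F) = 0 := by
      simp [expect, usedOnce]
    rw [this]
    have : 0 ≤ 1 - avoidProb (n + 1) k := by linarith
    positivity
  · rw [expect_usedOnce_succ hk]
    set a := avoidProb (n + 1) k with ha
    set a' := avoidProb n k with ha'
    have hd : (1 - a') - (1 - a) * a ≤ 3 * k ^ 2 / (n + 2) ^ 2 := by
      have e1 : (1 - a') - (1 - a) * a = k / (n + 1) - k / (n + 2) + (k / (n + 2)) ^ 2 := by
        rw [ha, ha']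
        unfold avoidProb
        push_cast
        field_simp
        ring
      rw [e1]
      have e2 : (k : ℝ) / (n + 1) - k / (n + 2) ≤ 2 * k / (n + 2) ^ 2 := by
        rw [div_sub_div _ _ (by positivity) (by positivity), div_le_div_iff₀ (by positivity)
          (by positivity)]
        have : (0 : ℝ) ≤ k * n * (n + 2) := by positivity
        nlinarith
      have e3 : 2 * (k : ℝ) / (n + 2) ^ 2 ≤ 2 * k ^ 2 / (n + 2) ^ 2 := by
        have : (1 : ℝ) ≤ k := by exact_mod_cast hm
        gcongr
        nlinarith
      have e4 : 2 * (k : ℝ) ^ 2 / (n + 2) ^ 2 + (k / (n + 2)) ^ 2 = 3 * k ^ 2 / (n + 2) ^ 2 := by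
        field_simp
        ring
      linarith
    push_cast at hμ ⊢
    have s1 : ((m : ℝ) + 1) * (1 - a') * a' ^ m ≤ ((m : ℝ) + 1 + 1) * (1 - a') * a ^ m := by
      have : 0 ≤ 1 - a' := by linarith
      gcongr
      linarith
    have s2 : ((m : ℝ) + 1 + 1) * (1 - a') * a ^ m - ((m : ℝ) + 1 + 1) * (1 - a) * a ^ (m + 1) ≤
        3 * μ * k ^ 2 / (n + 2) := by
      calc _ = ((m : ℝ) + 1 + 1) * a ^ m * ((1 - a') - (1 - a) * a) := by ring
        _ ≤ ((m : ℝ) + 1 + 1) * a ^ m * (3 * k ^ 2 / (n + 2) ^ 2) := by gcongr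
        _ ≤ (μ * (n + 2)) * 1 * (3 * k ^ 2 / (n + 2) ^ 2) := by
            gcongr
            exact pow_le_one₀ h4 h3
        _ = _ := by field_simp
    linarith

lemma expect_usedOnce_mul_usedOnce (hm : 1 ≤ k) (hb : |b| ≤ 1 / 2) {μ : ℝ}
    (hμ : (m : ℝ) + 1 ≤ μ * (n + 2)) {v w : Fin (n + 2)} (hvw : v ≠ w) :
    expect (weight (n + 2) k b)
        (fun F : Fin (m + 1) → ClauseData (n + 2) k => usedOnce w F * usedOnce v F) ≤
      ((m + 1) * (1 - avoidProb (n + 1) k) * avoidProb (n + 1) k ^ m) ^ 2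
        + 4 * μ * k ^ 2 / ((n + 2 : ℕ) : ℝ) := by
  have hk1 := hk.trans n.le_succ
  have h4 := avoidProb_nonneg hk1
  have h3 : avoidProb (n + 1) k ≤ 1 := avoidProb_le_one
  have hbound := expect_usedOnce_le (b := b) (m := m) hk hm hμ
  have hp1 : ((m : ℝ) + 1) * (1 - avoidProb (n + 1) k) * avoidProb (n + 1) k ^ m ≤ 1 := by
    rw [← expect_usedOnce_succ (b := b) hk1 v,
      ← expect_one (sum_weight (hk1.trans (Nat.le_succ _)) b)]
    exact expect_mono (weight_nonneg hb) fun F => usedOnce_le_one v F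
  have hn2 : (0 : ℝ) < n + 2 := by positivity
  have hμ0 : 0 ≤ μ := by
    by_contra! h
    nlinarith [(Nat.cast_nonneg m : (0 : ℝ) ≤ m)]
  obtain ⟨w, rfl⟩ := Fin.exists_succAbove_eq hvw.symm
  simp only [mul_comm (usedOnce (v.succAbove w) _)]
  rw [expect_usedOnce_mul hk1]
  set a := avoidProb (n + 1) k with ha
  set q := expect (weight (n + 1) k b)
    (fun F : Fin m → ClauseData (n + 1) k => usedOnce w F) with hq
  have hq0 : 0 ≤ q := expect_nonneg (weight_nonneg hb) fun F => usedOnce_nonneg w F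
  have hq1 := hbound w
  rw [← hq] at hq1
  -- Either the clause `d` also contains `w`, which is charged in full, or `w` is used once among
  -- the remaining clauses, which has probability `q`.
  have hin : ∀ (i : Fin (m + 1)) d, expect (weight (n + 1) k b) (fun F : Fin m → _ =>
      usedOnce (v.succAbove w) (i.insertNth d (skip v ∘ F) : Fin (m + 1) → ClauseData (n + 2) k)) ≤
      (1 - avoids (v.succAbove w) d) + q := by
    intro i d
    rw [hq, ← expect_const (m := m) (sum_weight hk1 b) (1 - avoids (v.succAbove w) d), ← expect_add]
    refine expect_mono (weight_nonneg hb) fun F => ?_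
    rw [usedOnce_insertNth, unused_skip, usedOnce_skip]
    have t1 := avoids_nonneg (v.succAbove w) d
    have t2 := avoids_le_one (v.succAbove w) d
    have t3 := unused_le_one w F
    have t4 := usedOnce_nonneg w F
    nlinarith
  have hsum : ∀ i : Fin (m + 1), ∑ d, weight (n + 2) k b d * ((1 - avoids v d) * (a ^ m *
      expect (weight (n + 1) k b) (fun F : Fin m → _ =>
      usedOnce (v.succAbove w)
        (i.insertNth d (skip v ∘ F) : Fin (m + 1) → ClauseData (n + 2) k)))) ≤
      a ^ m * ((1 - a) ^ 2 + (1 - a) * q) := by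
    intro i
    calc _ ≤ ∑ d, weight (n + 2) k b d * ((1 - avoids v d) * (a ^ m *
          ((1 - avoids (v.succAbove w) d) + q))) := by
            refine Finset.sum_le_sum fun d _ => ?_
            have t0 := weight_nonneg hb d
            have t1 : 0 ≤ 1 - avoids v d := by linarith [avoids_le_one v d]
            gcongr
            exact hin i d
      _ = a ^ m * (∑ d, weight (n + 2) k b d * ((1 - avoids v d) * (1 - avoids (v.succAbove w) d))
          + (∑ d, weight (n + 2) k b d * (1 - avoids v d)) * q) := by
            rw [Finset.sum_mul, ← Finset.sum_add_distrib, Finset.mul_sum]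
            exact Finset.sum_congr rfl fun d _ => by ring
      _ ≤ _ := by
            rw [sum_weight_not_avoids hk1, ← ha]
            gcongr
            exact sum_weight_not_avoids_mul hk b
  refine (Finset.sum_le_sum fun i _ => hsum i).trans ?_
  rw [Finset.sum_const, Finset.card_univ, Fintype.card_fin, nsmul_eq_mul]
  push_cast
  have ham : a ^ m ≤ 1 := pow_le_one₀ h4 h3
  have ham0 : 0 ≤ a ^ m := pow_nonneg h4 m
  have ha1 : 0 ≤ 1 - a := by linarith
  set p := ((m : ℝ) + 1) * (1 - a) * a ^ m with hp
  have hp0 : 0 ≤ p := by positivity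
  have u1 : ((m : ℝ) + 1) * (a ^ m * (1 - a) ^ 2) ≤ μ * k ^ 2 / (n + 2) := by
    have e : 1 - a = k / (n + 2) := by
      rw [ha]; unfold avoidProb; push_cast; ring
    calc _ ≤ (μ * (n + 2)) * (1 * (1 - a) ^ 2) := by gcongr
      _ = _ := by rw [e]; field_simp
  have u2 : p * q ≤ p ^ 2 + 3 * μ * k ^ 2 / (n + 2) := by
    have : 0 ≤ 3 * μ * (k : ℝ) ^ 2 / (n + 2) := by positivity
    nlinarith
  calc _ = ((m : ℝ) + 1) * (a ^ m * (1 - a) ^ 2) + p * q := by rw [hp]; ring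
    _ ≤ μ * k ^ 2 / (n + 2) + (p ^ 2 + 3 * μ * k ^ 2 / (n + 2)) := add_le_add u1 u2
    _ = _ := by ring

end Occurrence

/-! ### Adding one clause changes the probability of satisfiability by `O(n ^ (-1/2))` -/

lemma exp_neg_two_mul_le {x : ℝ} (h0 : 0 ≤ x) (h1 : x ≤ 1 / 2) : Real.exp (-(2 * x)) ≤ 1 - x := by
  rw [Real.exp_neg, inv_le_comm₀ (Real.exp_pos _) (by linarith)]
  refine le_trans ?_ (Real.add_one_le_exp (2 * x))
  rw [inv_le_iff_one_le_mul₀ (by linarith)]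
  nlinarith

lemma le_div_sqrt_of_mul_le {N E x y c : ℝ} (hN : 0 < N) (hE : 0 < E) (hx : E ≤ x) (hc : 0 ≤ c)
    (h : N * x * y ≤ c * √N) : y ≤ c * E⁻¹ / √N := by
  have hs : 0 < √N := Real.sqrt_pos.2 hN
  have hss : √N * √N = N := Real.mul_self_sqrt hN.le
  rcases le_or_gt y 0 with hy | hy
  · exact hy.trans (by positivity)
  rw [le_div_iff₀ hs, ← div_eq_mul_inv, le_div_iff₀ hE]
  have h1 : √N * (y * √N * E) ≤ √N * c := by
    calc _ = √N * √N * E * y := by ring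
      _ = N * E * y := by rw [hss]
      _ ≤ N * x * y := by gcongr
      _ ≤ _ := by linarith
  exact le_of_mul_le_mul_left h1 hs

/-- The constant in the bound for the effect of a single clause. -/
noncomputable def clauseConst (k : ℕ) (μ : ℝ) : ℝ :=
  (2 + (4 * μ * k ^ 2 + 2) * 4) * (Real.exp (-(2 * (k * μ))))⁻¹

/-- Both probabilities are compared with `S`, for `m + 1` clauses on `n + 2` variables: unused
variables bound `S - P1`, variables used once bound `P0 - S`. -/
lemma expect_satInd_sub_succ_le {n k m : ℕ} {b μ : ℝ} (hk1 : 1 ≤ k) (hk : 2 * k ≤ n)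
    (hb : |b| ≤ 1 / 2) (hμ : (m : ℝ) + 1 ≤ μ * (n + 2)) (hm : ((n : ℝ) + 2) / 4 ≤ m + 1) :
    expect (weight (n + 1) k b) (satInd (n := n + 1) (k := k) (m := m)) -
      expect (weight (n + 1) k b) (satInd (n := n + 1) (k := k) (m := m + 1)) ≤
      clauseConst k μ / √((n + 2 : ℕ) : ℝ) := by
  have hkn : k ≤ n := by omega
  have hkn1 : k ≤ n + 1 := by omega
  have hkn2 : k ≤ n + 2 := by omega
  have hN : (0 : ℝ) < ((n + 2 : ℕ) : ℝ) := by positivity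
  have hn2 : (0 : ℝ) < n + 2 := by positivity
  have hμ0 : 0 ≤ μ := by
    by_contra! h
    nlinarith [(Nat.cast_nonneg m : (0 : ℝ) ≤ m)]
  have hnn := weight_nonneg (n := n + 2) (k := k) hb
  have hone := sum_weight hkn2 b
  set S := expect (weight (n + 2) k b) (satInd (n := n + 2) (k := k) (m := m + 1)) with hS
  set P0 := expect (weight (n + 1) k b) (satInd (n := n + 1) (k := k) (m := m))
  set P1 := expect (weight (n + 1) k b) (satInd (n := n + 1) (k := k) (m := m + 1))
  set a := avoidProb (n + 1) k with ha
  have ha0 : 0 ≤ a := avoidProb_nonneg hkn1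
  have ha1 : a ≤ 1 := avoidProb_le_one
  have hu := abs_sum_expect_sub_le hnn hone
    (fun (v : Fin (n + 2)) (F : Fin (m + 1) → ClauseData (n + 2) k) => unused v F)
    (fun _ _ => unused_nonneg _ _) (fun _ _ => unused_le_one _ _) le_rfl
    (fun v => expect_unused hkn1 v)
    (fun v w hvw => by simpa using expect_unused_mul_unused hkn hvw)
    satInd_nonneg satInd_le_one
  have ho := abs_sum_expect_sub_le hnn hone
    (fun (v : Fin (n + 2)) (F : Fin (m + 1) → ClauseData (n + 2) k) => usedOnce v F)
    (fun _ _ => usedOnce_nonneg _ _) (fun _ _ => usedOnce_le_one _ _)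
    (c := 4 * μ * k ^ 2) (by positivity)
    (fun v => expect_usedOnce_succ hkn1 v)
    (fun v w hvw => expect_usedOnce_mul_usedOnce hkn hk1 hb hμ hvw)
    satInd_nonneg satInd_le_one
  simp only [expect_unused_mul_satInd hkn1, expect_usedOnce_mul_satInd hkn1, Finset.sum_const,
    Finset.card_univ, Fintype.card_fin, nsmul_eq_mul] at hu ho
  have ha' : a = 1 - k / (n + 2) := by rw [ha]; unfold avoidProb; push_cast; ring
  have hE : Real.exp (-(2 * (k * μ))) ≤ a ^ (m + 1) := by
    have h1 : Real.exp (-(2 * ((k : ℝ) / (n + 2)))) ≤ a := by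
      rw [ha']
      refine exp_neg_two_mul_le (by positivity) ?_
      rw [div_le_div_iff₀ hn2 (by norm_num)]
      have : (2 : ℝ) * k ≤ n := by exact_mod_cast hk
      linarith
    refine le_trans ?_ (pow_le_pow_left₀ (Real.exp_pos _).le h1 _)
    rw [← Real.exp_nat_mul]
    refine Real.exp_le_exp.2 ?_
    have h2 : (k : ℝ) / (n + 2) * (m + 1) ≤ k * μ := by
      rw [div_mul_eq_mul_div, div_le_iff₀ hn2, mul_assoc]
      gcongr
    push_cast
    linarith
  have hE0 := Real.exp_pos (-(2 * (k * μ)))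
  -- The lower bound on the density enters here: the mean number `(m + 1) k / (n + 2)` of
  -- occurrences of a variable is at least `1/4`.
  have hp : Real.exp (-(2 * (k * μ))) / 4 ≤ (m + 1) * (1 - a) * a ^ m := by
    have h1 : a ^ (m + 1) ≤ a ^ m := pow_le_pow_of_le_one ha0 ha1 (Nat.le_succ m)
    have h2 : 1 / 4 ≤ ((m : ℝ) + 1) * (1 - a) := by
      have e : 1 - a = k / (n + 2) := by rw [ha']; ring
      rw [e, mul_div_assoc', le_div_iff₀ hn2]
      have : (1 : ℝ) ≤ k := by exact_mod_cast hk1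
      nlinarith
    calc _ = 1 / 4 * Real.exp (-(2 * (k * μ))) := by ring
      _ ≤ ((m : ℝ) + 1) * (1 - a) * a ^ m := mul_le_mul h2 (hE.trans h1) hE0.le (by linarith)
  have r1 : S - P1 ≤ 2 * (Real.exp (-(2 * (k * μ))))⁻¹ / √((n + 2 : ℕ) : ℝ) := by
    refine le_div_sqrt_of_mul_le hN hE0 hE (by norm_num) ?_
    have := (abs_le.1 hu).1
    linarith
  have r2 : P0 - S ≤ (4 * μ * k ^ 2 + 2) * (Real.exp (-(2 * (k * μ))) / 4)⁻¹ /
      √((n + 2 : ℕ) : ℝ) := by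
    refine le_div_sqrt_of_mul_le hN (by positivity) hp (by positivity) ?_
    have := (abs_le.1 ho).2
    linarith
  have r3 : clauseConst k μ / √((n + 2 : ℕ) : ℝ) =
      2 * (Real.exp (-(2 * (k * μ))))⁻¹ / √((n + 2 : ℕ) : ℝ) +
      (4 * μ * k ^ 2 + 2) * (Real.exp (-(2 * (k * μ))) / 4)⁻¹ / √((n + 2 : ℕ) : ℝ) := by
    unfold clauseConst
    field_simp
  linarith

/-! ### Sums over injective tuples -/

section Tuples

variable {n k : ℕ}

lemma sum_prod_tuple (f : Fin n → ℝ) : ∑ K : Fin k → Fin n, ∏ j, f (K j) = (∑ v, f v) ^ k :=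
  (Fintype.sum_pow f k).symm

/-- Union bound over pairs of positions. If positions `j` and `l` agree, the factor at `j` is
dropped using `e ≤ 1`, leaving a free tuple of length `k - 1`. -/
lemma sum_not_injective_le {e : Fin n → ℝ} (he0 : ∀ v, 0 ≤ e v) (he1 : ∀ v, e v ≤ 1) :
    ∑ K : Fin k → Fin n, (if Function.Injective K then 0 else ∏ j, e (K j)) ≤
      k ^ 2 * (∑ v, e v) ^ (k - 1) := by
  have hprod : ∀ {k : ℕ} (K : Fin k → Fin n), 0 ≤ ∏ j, e (K j) :=
    fun K => Finset.prod_nonneg fun _ _ => he0 _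
  have hpair : ∀ j l : Fin k, j ≠ l →
      ∑ K : Fin k → Fin n, (if K j = K l then ∏ i, e (K i) else 0) ≤ (∑ v, e v) ^ (k - 1) := by
    intro j l hjl
    rcases k with _ | k
    · exact j.elim0
    obtain ⟨l, rfl⟩ := Fin.exists_succAbove_eq hjl.symm
    rw [← (Fin.insertNthEquiv (fun _ => Fin n) j).sum_comp, Fintype.sum_prod_type_right,
      Nat.add_sub_cancel, ← sum_prod_tuple]
    refine Finset.sum_le_sum fun K _ => ?_
    simp only [Fin.insertNthEquiv_apply, Fin.insertNth_apply_same, Fin.insertNth_apply_succAbove,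
      Fin.prod_univ_succAbove _ j, Finset.sum_ite_eq', Finset.mem_univ, if_true]
    exact mul_le_of_le_one_left (hprod K) (he1 _)
  have hpt : ∀ K : Fin k → Fin n, (if Function.Injective K then 0 else ∏ j, e (K j)) ≤
      ∑ j, ∑ l, if j ≠ l then (if K j = K l then ∏ i, e (K i) else 0) else 0 := by
    intro K
    have hterm : ∀ j l, 0 ≤ if j ≠ l then (if K j = K l then ∏ i, e (K i) else 0) else 0 := by
      intro j l
      split_ifs <;> first | exact hprod K | exact le_rfl
    split_ifs with hK
    · exact Finset.sum_nonneg fun j _ => Finset.sum_nonneg fun l _ => hterm j l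
    · simp only [Function.Injective, not_forall] at hK
      obtain ⟨j, l, h, hjl⟩ := hK
      calc ∏ i, e (K i) = if j ≠ l then (if K j = K l then ∏ i, e (K i) else 0) else 0 := by
            simp [h, hjl]
        _ ≤ ∑ l, if j ≠ l then (if K j = K l then ∏ i, e (K i) else 0) else 0 :=
            Finset.single_le_sum (f := fun l => if j ≠ l then
              (if K j = K l then ∏ i, e (K i) else 0) else 0)
              (fun l _ => hterm j l) (Finset.mem_univ l)
        _ ≤ _ := Finset.single_le_sum (f := fun j => ∑ l, if j ≠ l then
              (if K j = K l then ∏ i, e (K i) else 0) else 0)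
              (fun j _ => Finset.sum_nonneg fun l _ => hterm j l) (Finset.mem_univ j)
  refine (Finset.sum_le_sum fun K _ => hpt K).trans ?_
  rw [Finset.sum_comm]
  have hX : 0 ≤ (∑ v, e v) ^ (k - 1) := pow_nonneg (Finset.sum_nonneg fun v _ => he0 v) _
  calc _ ≤ ∑ _j : Fin k, ∑ _l : Fin k, (∑ v, e v) ^ (k - 1) := by
        refine Finset.sum_le_sum fun j _ => ?_
        rw [Finset.sum_comm]
        refine Finset.sum_le_sum fun l _ => ?_
        by_cases hjl : j = l
        · simpa [hjl] using hX
        · simpa [hjl] using hpair j l hjl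
    _ = _ := by
        simp
        ring

variable {e β : Fin n → ℝ} (he1 : ∀ v, e v ≤ 1) (hβ : ∀ v, |β v| ≤ e v)

/-- The product `∏ j, (e / 2 + b β)` along the tuple `K`. -/
noncomputable def tupleProd (e β : Fin n → ℝ) (b : ℝ) (K : Fin k → Fin n) : ℝ :=
  ∏ j, (e (K j) / 2 + b * β (K j))

lemma sum_tupleProd (e β : Fin n → ℝ) (b : ℝ) : ∑ K : Fin k → Fin n, tupleProd e β b K =
    ((∑ v, e v) / 2 + b * ∑ v, β v) ^ k := by
  unfold tupleProd
  rw [sum_prod_tuple fun v => e v / 2 + b * β v, Finset.sum_add_distrib, ← Finset.sum_div,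
    ← Finset.mul_sum]

include hβ in
lemma abs_factor_le {b : ℝ} (hb : |b| ≤ 1 / 2) (v : Fin n) : |e v / 2 + b * β v| ≤ e v := by
  have h0 : 0 ≤ e v := (abs_nonneg _).trans (hβ v)
  calc _ ≤ |e v / 2| + |b * β v| := abs_add_le _ _
    _ = e v / 2 + |b| * |β v| := by rw [abs_mul, abs_of_nonneg (by positivity : 0 ≤ e v / 2)]
    _ ≤ e v / 2 + 1 / 2 * e v := by gcongr; exact hβ v
    _ = e v := by ring

include hβ in
lemma abs_tupleProd_le {b : ℝ} (hb : |b| ≤ 1 / 2) (K : Fin k → Fin n) :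
    |tupleProd e β b K| ≤ ∏ j, e (K j) := by
  rw [tupleProd, Finset.abs_prod]
  exact Finset.prod_le_prod (fun _ _ => abs_nonneg _) fun j _ => abs_factor_le hβ hb _

include hβ in
lemma exists_hasDerivAt_tupleProd {b : ℝ} (hb : |b| ≤ 1 / 2) (K : Fin k → Fin n) :
    ∃ t, HasDerivAt (fun b => tupleProd e β b K) t b ∧ |t| ≤ k * ∏ j, e (K j) := by
  refine ⟨_, HasDerivAt.fun_finsetProd fun j _ =>
    ((hasDerivAt_id b).mul_const (β (K j))).const_add (e (K j) / 2), ?_⟩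
  refine (Finset.abs_sum_le_sum_abs _ _).trans ?_
  calc _ ≤ ∑ _j : Fin k, ∏ j, e (K j) := by
        refine Finset.sum_le_sum fun j _ => ?_
        rw [← Finset.prod_erase_mul _ _ (Finset.mem_univ j), smul_eq_mul, abs_mul, Finset.abs_prod,
          one_mul]
        exact mul_le_mul (Finset.prod_le_prod (fun _ _ => abs_nonneg _)
          fun i _ => abs_factor_le hβ hb _) (hβ _) (abs_nonneg _)
          (Finset.prod_nonneg fun _ _ => (abs_nonneg _).trans (hβ _))
    _ = _ := by simp

/-- The sum over injective tuples of `∏ (e / 2 + b β) + ∏ (e / 2 - b β)`. -/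
noncomputable def injSum (k : ℕ) (e β : Fin n → ℝ) (b : ℝ) : ℝ :=
  ∑ K : Fin k → Fin n, if Function.Injective K then tupleProd e β b K + tupleProd e (-β) b K else 0

lemma injSum_eq (e β : Fin n → ℝ) (b : ℝ) : injSum k e β b =
    ((∑ v, e v) / 2 + b * ∑ v, β v) ^ k + ((∑ v, e v) / 2 - b * ∑ v, β v) ^ k -
      ∑ K : Fin k → Fin n, if Function.Injective K then 0 else
        tupleProd e β b K + tupleProd e (-β) b K := by
  have h : ((∑ v, e v) / 2 - b * ∑ v, β v) ^ k = ∑ K : Fin k → Fin n, tupleProd e (-β) b K := by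
    rw [sum_tupleProd]
    simp [sub_eq_add_neg]
  rw [h, ← sum_tupleProd, ← Finset.sum_add_distrib, ← Finset.sum_sub_distrib, injSum]
  refine Finset.sum_congr rfl fun K _ => ?_
  split_ifs <;> simp

include hβ in
lemma abs_sum_mul_le {b : ℝ} (hb : |b| ≤ 1 / 2) : |b * ∑ v, β v| ≤ (∑ v, e v) / 2 := by
  have : |∑ v, β v| ≤ ∑ v, e v :=
    (Finset.abs_sum_le_sum_abs _ _).trans (Finset.sum_le_sum fun v _ => hβ v)
  rw [abs_mul]
  have := mul_le_mul hb this (abs_nonneg _) (by norm_num)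
  linarith

include hβ he1 in
-- Power mean inequality for `s/2 + b d` and `s/2 - b d`, which are nonnegative with sum `s`;
-- repeated variables cost the second term.
lemma le_injSum {b : ℝ} (hb : |b| ≤ 1 / 2) :
    (∑ v, e v) ^ k / 2 ^ (k - 1) - 2 * k ^ 2 * (∑ v, e v) ^ (k - 1) ≤ injSum k e β b := by
  have he0 : ∀ v, 0 ≤ e v := fun v => (abs_nonneg _).trans (hβ v)
  rw [injSum_eq]
  have h1 := abs_le.1 (abs_sum_mul_le hβ hb)
  have h2 := add_pow_le (a := (∑ v, e v) / 2 + b * ∑ v, β v)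
    (b := (∑ v, e v) / 2 - b * ∑ v, β v) (by linarith) (by linarith) k
  have h3 : (∑ v, e v) / 2 + b * ∑ v, β v + ((∑ v, e v) / 2 - b * ∑ v, β v) = ∑ v, e v := by ring
  rw [h3, ← div_le_iff₀' (by positivity)] at h2
  have hβ' : ∀ v, |(-β) v| ≤ e v := fun v => by simpa using hβ v
  have h4 : ∑ K : Fin k → Fin n, (if Function.Injective K then 0 else
      tupleProd e β b K + tupleProd e (-β) b K) ≤ 2 * (k ^ 2 * (∑ v, e v) ^ (k - 1)) := by
    calc _ ≤ ∑ K : Fin k → Fin n, 2 * (if Function.Injective K then 0 else ∏ j, e (K j)) := by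
          refine Finset.sum_le_sum fun K _ => ?_
          split_ifs
          · simp
          · linarith [(abs_le.1 (abs_tupleProd_le hβ hb K)).2,
              (abs_le.1 (abs_tupleProd_le hβ' hb K)).2]
      _ ≤ _ := by
          rw [← Finset.mul_sum]
          exact mul_le_mul_of_nonneg_left (sum_not_injective_le he0 he1) (by norm_num)
  linarith

include hβ he1 in
-- The sign `b ≥ 0` is decisive: the derivative of the main term is `k d ((s/2 + b d)^(k-1) - (s/2 -
-- b d)^(k-1)) ≥ 0`. Only repeated variables contribute negatively.
lemma exists_hasDerivAt_injSum {b : ℝ} (hb : |b| ≤ 1 / 2) (hb0 : 0 ≤ b) :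
    ∃ t, HasDerivAt (injSum k e β) t b ∧ -(2 * k ^ 3 * (∑ v, e v) ^ (k - 1)) ≤ t := by
  have he0 : ∀ v, 0 ≤ e v := fun v => (abs_nonneg _).trans (hβ v)
  have hβ' : ∀ v, |(-β) v| ≤ e v := fun v => by simpa using hβ v
  choose t1 ht1 hb1 using exists_hasDerivAt_tupleProd (k := k) hβ hb
  choose t2 ht2 hb2 using exists_hasDerivAt_tupleProd (k := k) hβ' hb
  set s := ∑ v, e v with hs
  set d := ∑ v, β v with hd
  have hR : HasDerivAt (fun b => ∑ K : Fin k → Fin n, if Function.Injective K then 0 else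
      tupleProd e β b K + tupleProd e (-β) b K)
      (∑ K : Fin k → Fin n, if Function.Injective K then 0 else t1 K + t2 K) b := by
    refine HasDerivAt.fun_sum fun K _ => ?_
    by_cases hK : Function.Injective K
    · simpa [hK] using hasDerivAt_const b (0 : ℝ)
    · simpa [hK] using (ht1 K).fun_add (ht2 K)
  have hF1 : HasDerivAt (fun b => (s / 2 + b * d) ^ k)
      (k * (s / 2 + b * d) ^ (k - 1) * d) b := by
    simpa using (((hasDerivAt_id b).mul_const d).const_add (s / 2)).fun_pow k
  have hF2 : HasDerivAt (fun b => (s / 2 - b * d) ^ k)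
      (k * (s / 2 - b * d) ^ (k - 1) * (-d)) b := by
    simpa using (((hasDerivAt_id b).mul_const d).const_sub (s / 2)).fun_pow k
  refine ⟨_, ((hF1.add hF2).sub hR).congr_of_eventuallyEq
    (Filter.Eventually.of_forall fun b => injSum_eq e β b), ?_⟩
  have hbd := abs_le.1 (abs_sum_mul_le hβ hb)
  rw [← hs, ← hd] at hbd
  have hpos : 0 ≤ k * (s / 2 + b * d) ^ (k - 1) * d + k * (s / 2 - b * d) ^ (k - 1) * (-d) := by
    have : k * (s / 2 + b * d) ^ (k - 1) * d + k * (s / 2 - b * d) ^ (k - 1) * (-d) =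
        k * (((s / 2 + b * d) ^ (k - 1) - (s / 2 - b * d) ^ (k - 1)) * d) := by ring
    rw [this]
    refine mul_nonneg (by positivity) ?_
    rcases le_total 0 d with h | h
    · refine mul_nonneg (sub_nonneg.2 (pow_le_pow_left₀ (by linarith) ?_ _)) h
      nlinarith
    · refine mul_nonneg_of_nonpos_of_nonpos
        (sub_nonpos.2 (pow_le_pow_left₀ (by linarith) ?_ _)) h
      nlinarith
  have hRle : ∑ K : Fin k → Fin n, (if Function.Injective K then 0 else t1 K + t2 K) ≤
      2 * k * (k ^ 2 * s ^ (k - 1)) := by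
    calc _ ≤ ∑ K : Fin k → Fin n, 2 * k * (if Function.Injective K then 0 else ∏ j, e (K j)) := by
          refine Finset.sum_le_sum fun K _ => ?_
          split_ifs
          · simp
          · linarith [(abs_le.1 (hb1 K)).2, (abs_le.1 (hb2 K)).2]
      _ ≤ _ := by
          rw [← Finset.mul_sum]
          exact mul_le_mul_of_nonneg_left (sum_not_injective_le he0 he1) (by positivity)
  linarith

end Tuples

/-! ### Frozen variables and the effect of one more clause -/

section Frozen

variable {n k m : ℕ}

open Classical in
/-- The indicator that the literal `(v, s)` is false under every satisfying assignment. -/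
noncomputable def refuted (F : Fin m → ClauseData n k) (v : Fin n) (s : ℤˣ) : ℝ :=
  if ∀ σ : Assignment n, (∀ i, (F i).toClause.Holds σ) → σ v ≠ s then 1 else 0

/-- For satisfiable `F`, the indicator that `v` takes the same value in every solution. -/
noncomputable def frozen (F : Fin m → ClauseData n k) (v : Fin n) : ℝ :=
  refuted F v 1 + refuted F v (-1)

/-- For satisfiable `F`, the common value of the frozen variable `v` and `0` if `v` is not
frozen. -/
noncomputable def frozenSign (F : Fin m → ClauseData n k) (v : Fin n) : ℝ :=
  refuted F v (-1) - refuted F v 1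

lemma refuted_eq (F : Fin m → ClauseData n k) (v : Fin n) (s : ℤˣ) :
    refuted F v s = 0 ∨ refuted F v s = 1 := by
  unfold refuted; split_ifs <;> simp

lemma refuted_nonneg (F : Fin m → ClauseData n k) (v : Fin n) (s : ℤˣ) : 0 ≤ refuted F v s := by
  rcases refuted_eq F v s with h | h <;> simp [h]

lemma abs_frozenSign_le (F : Fin m → ClauseData n k) (v : Fin n) :
    |frozenSign F v| ≤ frozen F v := by
  rw [abs_le]
  unfold frozenSign frozen
  constructor <;> linarith [refuted_nonneg F v 1, refuted_nonneg F v (-1)]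

lemma satInd_eq (F : Fin m → ClauseData n k) : satInd F = 0 ∨ satInd F = 1 := by
  unfold satInd; split_ifs <;> simp

lemma satisfiable_of_satInd {F : Fin m → ClauseData n k} (h : satInd F = 1) :
    Formula.Satisfiable fun i => (F i).toClause := by
  by_contra h'
  simp [satInd, h'] at h

/-- Satisfiability is essential: if `F` has no solution, both signs are refuted and `frozen` equals
2. -/
lemma frozen_le_one {F : Fin m → ClauseData n k} (h : satInd F = 1) (v : Fin n) :
    frozen F v ≤ 1 := by
  obtain ⟨σ, hσ⟩ := satisfiable_of_satInd h
  have h0 : refuted F v (σ v) = 0 := by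
    unfold refuted
    rw [if_neg]
    exact fun h => h σ hσ rfl
  have hle : ∀ s, refuted F v s ≤ 1 := fun s => by
    rcases refuted_eq F v s with h | h <;> simp [h]
  unfold frozen
  rcases Int.units_eq_one_or (σ v) with hs | hs <;> rw [hs] at h0 <;>
    linarith [hle 1, hle (-1)]

lemma satInd_insertNth (i : Fin (m + 1)) (d : ClauseData n k) (F : Fin m → ClauseData n k) :
    satInd (i.insertNth d F : Fin (m + 1) → ClauseData n k) =
      satInd F * (1 - ∏ j, refuted F (d.1 j) (d.2.1 * d.2.2 j)) := by
  have hiff : (Formula.Satisfiable fun l =>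
      ((i.insertNth d F : Fin (m + 1) → ClauseData n k) l).toClause) ↔
      ∃ σ : Assignment n, d.toClause.Holds σ ∧ ∀ l, (F l).toClause.Holds σ := by
    refine exists_congr fun σ => ?_
    rw [Fin.forall_iff_succAbove i]
    simp only [Fin.insertNth_apply_same, Fin.insertNth_apply_succAbove]
  rcases satInd_eq F with h | h
  · rw [h, zero_mul]
    unfold satInd at h ⊢
    rw [if_neg]
    rw [hiff]
    rintro ⟨σ, -, hσ⟩
    rw [if_pos ⟨σ, hσ⟩] at h
    exact one_ne_zero h
  · rw [h, one_mul]
    by_cases hex : ∃ σ : Assignment n, d.toClause.Holds σ ∧ ∀ l, (F l).toClause.Holds σ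
    · rw [satInd, if_pos (hiff.2 hex)]
      obtain ⟨σ, ⟨j, hj⟩, hσ⟩ := hex
      rw [Finset.prod_eq_zero (Finset.mem_univ j), sub_zero]
      unfold refuted
      rw [if_neg]
      exact fun h => h σ hσ hj
    · rw [satInd, if_neg (hiff.not.2 hex), Finset.prod_eq_one, sub_self]
      intro j _
      unfold refuted
      rw [if_pos]
      exact fun σ hσ hj => hex ⟨σ, ⟨j, hj⟩, hσ⟩

/-- Given `B = 1`, a position holding `v` is refuted with probability `frozen / 2 + b * frozenSign`;
`B = -1` reverses the sign of `b`. These are the two products in `injSum`. -/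
lemma sum_weight_satInd_insertNth (hk : k ≤ n) (b : ℝ) (i : Fin (m + 1))
    (F : Fin m → ClauseData n k) :
    ∑ d, weight n k b d * satInd (i.insertNth d F : Fin (m + 1) → ClauseData n k) =
      satInd F * (1 - ((n.descFactorial k : ℕ) : ℝ)⁻¹ * (1 / 2) *
        injSum k (frozen F) (frozenSign F) b) := by
  have h : ∑ d, weight n k b d * satInd (i.insertNth d F : Fin (m + 1) → ClauseData n k) =
      satInd F * (∑ d, weight n k b d - ∑ d : ClauseData n k, weight n k b d *
        ∏ j, refuted F (d.1 j) (d.2.1 * d.2.2 j)) := by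
    rw [← Finset.sum_sub_distrib, Finset.mul_sum]
    refine Finset.sum_congr rfl fun d _ => ?_
    rw [satInd_insertNth]
    ring
  rw [h, sum_weight hk, sum_weight_mul_prod]
  congr 3
  refine Finset.sum_congr rfl fun K _ => ?_
  simp only [tupleProd, frozen, frozenSign, Pi.neg_apply]
  split_ifs
  · congr 1 <;> exact Finset.prod_congr rfl fun j _ => by ring
  · rfl

end Frozen

/-! ### The satisfiability probability as a finite sum -/

section Law

lemma signLaw_ne_top (p : ℝ) : signLaw p Set.univ ≠ ⊤ := by
  simp [signLaw]

instance (p : ℝ) : IsFiniteMeasure (signLaw p) := ⟨lt_top_iff_ne_top.2 (signLaw_ne_top p)⟩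

instance (n k : ℕ) (p : ℝ) : IsFiniteMeasure (clauseLaw n k p) := by
  unfold clauseLaw; infer_instance

instance (n k m : ℕ) (p : ℝ) : IsFiniteMeasure (formulaLaw n k m p) := by
  unfold formulaLaw; infer_instance

lemma signLaw_real_singleton {b : ℝ} (hb : |b| ≤ 1 / 2) (s : ℤˣ) :
    (signLaw (1 / 2 - b)).real {s} = 1 / 2 - ((s : ℤ) : ℝ) * b := by
  obtain ⟨h1, h2⟩ := abs_le.1 hb
  have h3 : (1 : ℝ) - (1 / 2 - b) = 1 / 2 + b := by ring
  rw [measureReal_def, signLaw, h3]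
  have hne : (-1 : ℤˣ) ≠ 1 := by decide
  rcases Int.units_eq_one_or s with rfl | rfl
  · simp only [Measure.add_apply, Measure.smul_apply, smul_eq_mul, Measure.dirac_apply,
      Set.indicator, Set.mem_singleton_iff, hne, if_true, if_false, mul_zero, add_zero,
      Pi.one_apply, mul_one]
    rw [ENNReal.toReal_ofReal (by linarith)]
    simp
  · simp only [Measure.add_apply, Measure.smul_apply, smul_eq_mul, Measure.dirac_apply,
      Set.indicator, Set.mem_singleton_iff, hne.symm, if_true, if_false, mul_zero, zero_add,
      Pi.one_apply, mul_one]
    rw [ENNReal.toReal_ofReal (by linarith)]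
    simp

lemma uniformOn_real_singleton (n k : ℕ) (K : Fin k → Fin n) :
    (uniformOn {K : Fin k → Fin n | Function.Injective K}).real {K} =
      if Function.Injective K then ((n.descFactorial k : ℕ) : ℝ)⁻¹ else 0 := by
  have hs : {K : Fin k → Fin n | Function.Injective K} =
      ((Finset.univ.filter fun K : Fin k → Fin n => Function.Injective K : Finset _) : Set _) := by
    ext; simp
  have ht : ({K} : Set (Fin k → Fin n)) = (({K} : Finset (Fin k → Fin n)) : Set _) := by simp
  rw [measureReal_def, hs, ht, uniformOn_apply_finset, card_injective]
  split_ifs with hK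
  · have : (Finset.univ.filter fun K : Fin k → Fin n => Function.Injective K) ∩ {K} = {K} := by
      ext L
      simp only [Finset.mem_inter, Finset.mem_filter, Finset.mem_univ, true_and,
        Finset.mem_singleton, and_iff_right_iff_imp]
      rintro rfl
      exact hK
    simp [this]
  · have : (Finset.univ.filter fun K : Fin k → Fin n => Function.Injective K) ∩ {K} = ∅ := by
      ext L
      simp only [Finset.mem_inter, Finset.mem_filter, Finset.mem_univ, true_and,
        Finset.mem_singleton, Finset.notMem_empty, iff_false, not_and]
      rintro hL rfl
      exact hK hL
    simp [this]

lemma clauseLaw_real_singleton {n k : ℕ} {b : ℝ} (hb : |b| ≤ 1 / 2) (d : ClauseData n k) :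
    (clauseLaw n k (1 / 2 - b)).real {d} = weight n k b d := by
  obtain ⟨K, B, P⟩ := d
  have h : ({(K, B, P)} : Set (ClauseData n k)) = {K} ×ˢ ({B} ×ˢ {P}) := by simp
  have hB : (signLaw (1 / 2)).real {B} = 1 / 2 := by
    simpa using signLaw_real_singleton (b := 0) (by norm_num) B
  rw [measureReal_def, clauseLaw, h, Measure.prod_prod, Measure.prod_prod, Measure.pi_singleton,
    ENNReal.toReal_mul, ENNReal.toReal_mul, ENNReal.toReal_prod, ← measureReal_def,
    ← measureReal_def, uniformOn_real_singleton, hB]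
  simp only [← measureReal_def, signLaw_real_singleton hb]
  rfl

/-- The range of `b` matters: beyond it `ENNReal.ofReal` truncates, while `weight` continues as a
polynomial. -/
lemma satProb_eq_expect (n k m : ℕ) {b : ℝ} (hb : |b| ≤ 1 / 2) :
    satProb n k m b = expect (weight n k b) (satInd (n := n) (k := k) (m := m)) := by
  classical
  have hs : {d : Fin m → ClauseData n k | Formula.Satisfiable fun i => (d i).toClause} =
      ((Finset.univ.filter fun d : Fin m → ClauseData n k =>
        Formula.Satisfiable fun i => (d i).toClause : Finset _) : Set _) := by
    ext; simp
  rw [satProb, hs, ← sum_measureReal_singleton, Finset.sum_filter]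
  refine Finset.sum_congr rfl fun F _ => ?_
  rw [formulaLaw, measureReal_def, Measure.pi_singleton, ENNReal.toReal_prod]
  simp only [← measureReal_def, clauseLaw_real_singleton hb, satInd]
  split_ifs <;> simp

end Law

/-! ### Differentiating with respect to the polarization -/

section Derivative

variable {Γ : Type*} [Fintype Γ] {m : ℕ}

/-- Product rule over the independent entries: each summand varies the law of one entry and averages
over the others. -/
lemma hasDerivAt_expect {W : ℝ → Γ → ℝ} {b : ℝ} (hW : ∀ C, DifferentiableAt ℝ (fun b => W b C) b)
    (f : (Fin (m + 1) → Γ) → ℝ) {g : Fin (m + 1) → (Fin m → Γ) → ℝ}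
    (hg : ∀ i F, HasDerivAt (fun b => ∑ C, W b C * f (i.insertNth C F)) (g i F) b) :
    HasDerivAt (fun b => expect (W b) f) (∑ i, expect (W b) (g i)) b := by
  have hg' : ∀ i F, g i F = ∑ C, deriv (fun b => W b C) b * f (i.insertNth C F) := fun i F =>
    (hg i F).unique (HasDerivAt.fun_sum fun C _ => (hW C).hasDerivAt.mul_const _)
  have h : HasDerivAt (fun b => expect (W b) f) (∑ F : Fin (m + 1) → Γ,
      (∑ i, (∏ j ∈ Finset.univ.erase i, W b (F j)) • deriv (fun b => W b (F i)) b) * f F) b :=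
    HasDerivAt.fun_sum fun F _ =>
      (HasDerivAt.fun_finsetProd fun i _ => (hW (F i)).hasDerivAt).mul_const _
  convert h using 1
  simp only [Finset.sum_mul]
  rw [Finset.sum_comm]
  refine Finset.sum_congr rfl fun i _ => ?_
  rw [← (Fin.insertNthEquiv (fun _ => Γ) i).sum_comp, Fintype.sum_prod_type_right]
  refine Finset.sum_congr rfl fun F _ => ?_
  rw [hg', Finset.mul_sum]
  refine Finset.sum_congr rfl fun C _ => ?_
  have he : Finset.univ.erase i = Finset.univ.image i.succAbove := by
    rw [Fin.image_succAbove_univ, Finset.compl_singleton]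
  rw [he, Finset.prod_image fun _ _ _ _ h => Fin.succAbove_right_injective h]
  simp only [Fin.insertNthEquiv_apply, Fin.insertNth_apply_same, Fin.insertNth_apply_succAbove,
    smul_eq_mul, mul_assoc]
  rfl

end Derivative

/-! ### Moments of the number of frozen variables -/

section Moments

variable {n k m : ℕ} {b : ℝ}

/-- The `l`-th moment of the number of frozen variables of a random formula, restricted to
satisfiable formulas. -/
noncomputable def frozenMoment (n k m : ℕ) (b : ℝ) (l : ℕ) : ℝ :=
  expect (weight n k b) fun F : Fin m → ClauseData n k => satInd F * (∑ v, frozen F v) ^ l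

lemma frozen_sum_nonneg (F : Fin m → ClauseData n k) : 0 ≤ ∑ v, frozen F v :=
  Finset.sum_nonneg fun _ _ => (abs_nonneg _).trans (abs_frozenSign_le F _)

lemma frozen_sum_le {F : Fin m → ClauseData n k} (h : satInd F = 1) : ∑ v, frozen F v ≤ n := by
  calc _ ≤ ∑ _v : Fin n, (1 : ℝ) := Finset.sum_le_sum fun v _ => frozen_le_one h v
    _ = n := by simp

lemma frozenMoment_nonneg (hb : |b| ≤ 1 / 2) (l : ℕ) : 0 ≤ frozenMoment n k m b l :=
  expect_nonneg (weight_nonneg hb) fun F =>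
    mul_nonneg (satInd_nonneg F) (pow_nonneg (frozen_sum_nonneg F) l)

lemma frozenMoment_le_pow (hk : k ≤ n) (hb : |b| ≤ 1 / 2) (l : ℕ) :
    frozenMoment n k m b l ≤ n ^ l := by
  rw [← expect_const (m := m) (sum_weight hk b) ((n : ℝ) ^ l)]
  refine expect_mono (weight_nonneg hb) fun F => ?_
  rcases satInd_eq F with h | h
  · rw [h]; simp
  · rw [h, one_mul]
    exact pow_le_pow_left₀ (frozen_sum_nonneg F) (frozen_sum_le h) l

/-- The difference on the right is the mean probability that one more clause destroys
satisfiability, bounded below through `le_injSum`. -/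
lemma frozenMoment_le_descFactorial_mul (hk : k ≤ n) (hb : |b| ≤ 1 / 2) :
    frozenMoment n k m b k / 2 ^ (k - 1) - 2 * k ^ 2 * frozenMoment n k m b (k - 1) ≤
      2 * n.descFactorial k *
        (expect (weight n k b) (satInd (n := n) (k := k) (m := m)) -
          expect (weight n k b) (satInd (n := n) (k := k) (m := m + 1))) := by
  have hN : (0 : ℝ) < n.descFactorial k := by exact_mod_cast Nat.descFactorial_pos.2 hk
  have hdiff : expect (weight n k b) (satInd (n := n) (k := k) (m := m)) -
      expect (weight n k b) (satInd (n := n) (k := k) (m := m + 1)) =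
      expect (weight n k b) fun F : Fin m → ClauseData n k =>
        satInd F * ((n.descFactorial k : ℝ)⁻¹ * (1 / 2) *
          injSum k (frozen F) (frozenSign F) b) := by
    have e : expect (weight n k b) (satInd (n := n) (k := k) (m := m + 1)) =
        expect (weight n k b) fun F : Fin m → ClauseData n k => ∑ d, weight n k b d *
          satInd (Fin.insertNth 0 d F : Fin (m + 1) → ClauseData n k) := by
      rw [expect_insertNth _ _ 0, expect_sum]
      exact Finset.sum_congr rfl fun d _ => (expect_mul_left _ _ _).symm
    rw [e, ← expect_sub]
    refine congrArg _ (funext fun F => ?_)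
    rw [sum_weight_satInd_insertNth hk]
    ring
  rw [hdiff, frozenMoment, frozenMoment, ← expect_mul_left, ← expect_mul_left, div_eq_inv_mul,
    ← expect_mul_left, ← expect_sub]
  refine expect_mono (weight_nonneg hb) fun F => ?_
  rcases satInd_eq F with h | h
  · simp [h]
  · have := le_injSum (k := k) (frozen_le_one h) (abs_frozenSign_le F) hb
    rw [h]
    field_simp at this ⊢
    linarith

lemma frozenMoment_le (hk1 : 1 ≤ k) (hk : k ≤ n) (hb : |b| ≤ 1 / 2) {D : ℝ}
    (hD : expect (weight n k b) (satInd (n := n) (k := k) (m := m)) -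
      expect (weight n k b) (satInd (n := n) (k := k) (m := m + 1)) ≤ D / √n) (hD0 : 0 ≤ D) :
    frozenMoment n k m b k ≤ n ^ k * (2 ^ k * (D + k ^ 2) / √n) := by
  have hn : (1 : ℝ) ≤ n := by exact_mod_cast hk1.trans hk
  have h1 := frozenMoment_le_descFactorial_mul (m := m) hk hb
  have h2 := frozenMoment_le_pow (m := m) hk hb (k - 1)
  have hs : 0 < √(n : ℝ) := Real.sqrt_pos.2 (by linarith)
  have hss : √(n : ℝ) * √n = n := Real.mul_self_sqrt (by linarith)
  have hs1 : 1 ≤ √(n : ℝ) := Real.one_le_sqrt.2 hn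
  have hdf : (n.descFactorial k : ℝ) ≤ n ^ k := by exact_mod_cast Nat.descFactorial_le_pow n k
  -- The trivial bound on the lower moment suffices here, since `n⁻¹ ≤ n^(-1/2)`.
  have hpow : (n : ℝ) ^ (k - 1) ≤ n ^ k / √n := by
    rw [le_div_iff₀ hs, ← Nat.sub_add_cancel hk1, pow_succ, Nat.add_sub_cancel]
    gcongr
    nlinarith
  have h3 : 2 * (n.descFactorial k : ℝ) *
        (expect (weight n k b) (satInd (n := n) (k := k) (m := m)) -
          expect (weight n k b) (satInd (n := n) (k := k) (m := m + 1))) ≤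
      2 * n ^ k * (D / √n) := by
    calc _ ≤ 2 * (n.descFactorial k : ℝ) * (D / √n) := by gcongr
      _ ≤ _ := by gcongr
  have h4 : frozenMoment n k m b k / 2 ^ (k - 1) ≤
      2 * n ^ k * (D / √n) + 2 * k ^ 2 * (n ^ k / √n) := by
    have : 2 * (k : ℝ) ^ 2 * frozenMoment n k m b (k - 1) ≤ 2 * k ^ 2 * (n ^ k / √n) := by
      gcongr
      exact h2.trans hpow
    linarith
  rw [div_le_iff₀ (by positivity)] at h4
  refine h4.trans (le_of_eq ?_)
  have : (2 : ℝ) ^ k = 2 * 2 ^ (k - 1) := by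
    rw [← pow_succ', Nat.sub_add_cancel hk1]
  rw [this]
  ring

lemma pow_pred_le_add {x t : ℝ} (hx : 0 ≤ x) (ht : 0 < t) (hk1 : 1 ≤ k) :
    x ^ (k - 1) ≤ t ^ (k - 1) + x ^ k / t := by
  rcases le_total x t with h | h
  · have := pow_le_pow_left₀ hx h (k - 1)
    have : 0 ≤ x ^ k / t := by positivity
    linarith
  · have : x ^ (k - 1) ≤ x ^ k / t := by
      rw [le_div_iff₀ ht]
      calc _ ≤ x ^ (k - 1) * x := by gcongr
        _ = x ^ k := by rw [← pow_succ, Nat.sub_add_cancel hk1]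
    have : 0 ≤ t ^ (k - 1) := by positivity
    linarith

lemma frozenMoment_pred_le (hk1 : 1 ≤ k) (hk : k ≤ n) (hb : |b| ≤ 1 / 2) {M : ℝ}
    (hM : frozenMoment n k m b k ≤ n ^ k * (M / √n)) :
    frozenMoment n k m b (k - 1) ≤
      n ^ (k - 1) * ((1 + M) * (n : ℝ) ^ (-(((k : ℝ) - 1) / (2 * k)))) := by
  have hn : (0 : ℝ) < n := by exact_mod_cast hk1.trans hk
  have hk0 : (0 : ℝ) < k := by exact_mod_cast hk1
  -- Splitting at `n * t` gives the two contributions `t ^ (k - 1)` and `n^(-1/2) / t`; this `t`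
  -- makes them equal.
  set t : ℝ := (n : ℝ) ^ (-(1 / (2 * (k : ℝ)))) with ht
  have ht0 : 0 < t := Real.rpow_pos_of_pos hn _
  have hr1 : t ^ (k - 1) = (n : ℝ) ^ (-(((k : ℝ) - 1) / (2 * k))) := by
    rw [ht, ← Real.rpow_natCast, ← Real.rpow_mul hn.le, Nat.cast_sub hk1]
    congr 1
    push_cast
    field_simp
  have hr2 : (√(n : ℝ))⁻¹ / t = (n : ℝ) ^ (-(((k : ℝ) - 1) / (2 * k))) := by
    rw [ht, Real.sqrt_eq_rpow, ← Real.rpow_neg hn.le, ← Real.rpow_sub hn]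
    congr 1
    field_simp
    ring
  have h1 : frozenMoment n k m b (k - 1) ≤
      n ^ (k - 1) * t ^ (k - 1) + (n : ℝ)⁻¹ * t⁻¹ * frozenMoment n k m b k := by
    rw [frozenMoment, frozenMoment, ← expect_mul_left,
      ← expect_const (m := m) (sum_weight hk b) ((n : ℝ) ^ (k - 1) * t ^ (k - 1)), ← expect_add]
    refine expect_mono (weight_nonneg hb) fun F => ?_
    rcases satInd_eq F with h | h
    · rw [h]
      have : 0 ≤ (n : ℝ) ^ (k - 1) * t ^ (k - 1) := by positivity
      simpa using this
    · have h2 := pow_pred_le_add (x := ∑ v, frozen F v) (t := n * t) (frozen_sum_nonneg F)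
        (by positivity) hk1
      rw [h, one_mul, one_mul, ← mul_pow]
      refine h2.trans (le_of_eq ?_)
      field_simp
  have h3 : (n : ℝ)⁻¹ * t⁻¹ * frozenMoment n k m b k ≤
      n ^ (k - 1) * (M * ((√(n : ℝ))⁻¹ / t)) := by
    calc _ ≤ (n : ℝ)⁻¹ * t⁻¹ * (n ^ k * (M / √n)) := by gcongr
      _ = _ := by
          rw [← Nat.sub_add_cancel hk1, pow_succ, Nat.add_sub_cancel]
          field_simp
  rw [hr1] at h1
  rw [hr2] at h3
  linarith

/-- The derivative of the satisfiability probability in terms of the number of frozen variables. -/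
lemma exists_hasDerivAt_expect_satInd (hk : k ≤ n) (hb : |b| ≤ 1 / 2) (hb0 : 0 ≤ b) :
    ∃ t, HasDerivAt (fun b => expect (weight n k b) (satInd (n := n) (k := k) (m := m + 1))) t b ∧
      t ≤ (m + 1) * ((n.descFactorial k : ℝ)⁻¹ * k ^ 3 * frozenMoment n k m b (k - 1)) := by
  have hder : ∀ F : Fin m → ClauseData n k, ∃ t : ℝ,
      HasDerivAt (fun b => satInd F * (1 - ((n.descFactorial k : ℕ) : ℝ)⁻¹ * (1 / 2) *
        injSum k (frozen F) (frozenSign F) b)) t b ∧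
      t ≤ (n.descFactorial k : ℝ)⁻¹ * k ^ 3 * (satInd F * (∑ v, frozen F v) ^ (k - 1)) := by
    intro F
    rcases satInd_eq F with h | h
    · refine ⟨0, ?_, by simp [h]⟩
      simpa [h] using hasDerivAt_const b (0 : ℝ)
    · obtain ⟨t, ht, hle⟩ := exists_hasDerivAt_injSum (k := k) (frozen_le_one h)
        (abs_frozenSign_le F) hb hb0
      refine ⟨_, ((ht.const_mul _).const_sub 1).const_mul _, ?_⟩
      rw [h, one_mul, one_mul]
      have hN : (0 : ℝ) ≤ (n.descFactorial k : ℝ)⁻¹ := by positivity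
      nlinarith
  choose g hg hgle using hder
  refine ⟨_, hasDerivAt_expect (W := weight n k) (fun d => ?_) _ (g := fun _ => g)
    (fun i F => ?_), ?_⟩
  · unfold weight
    fun_prop
  · simpa only [sum_weight_satInd_insertNth hk] using hg F
  · rw [Finset.sum_const, Finset.card_univ, Fintype.card_fin, nsmul_eq_mul]
    push_cast
    rw [frozenMoment, ← expect_mul_left _ ((n.descFactorial k : ℝ)⁻¹ * k ^ 3)]
    refine mul_le_mul_of_nonneg_left (expect_mono (weight_nonneg hb) hgle) ?_
    positivity

end Moments

/-! ### Assembling the derivative bound -/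

lemma clauseConst_nonneg (k : ℕ) {μ : ℝ} (hμ : 0 ≤ μ) : 0 ≤ clauseConst k μ := by
  unfold clauseConst
  positivity

lemma exists_hasDerivAt_expect_satInd_le {n k m : ℕ} {b μ : ℝ} (hk1 : 1 ≤ k) (hk : 2 * k + 1 ≤ n)
    (hb : |b| ≤ 1 / 2) (hb0 : 0 ≤ b) (hm : (n : ℝ) / 2 ≤ m + 1) (hμ : (m : ℝ) + 1 ≤ μ * n) :
    ∃ t, HasDerivAt (fun b => expect (weight n k b) (satInd (n := n) (k := k) (m := m + 1))) t b ∧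
      t ≤ μ * 2 ^ k * k ^ 3 * (1 + 2 ^ k * (clauseConst k μ + k ^ 2)) *
        (n : ℝ) ^ (-(((k : ℝ) - 1) / (2 * k))) := by
  obtain ⟨n, rfl⟩ : ∃ l, n = l + 1 := ⟨n - 1, by omega⟩
  have hkn : k ≤ n + 1 := by omega
  have hn : (0 : ℝ) < ((n + 1 : ℕ) : ℝ) := by positivity
  have hμ0 : 0 ≤ μ := by
    by_contra! h
    nlinarith [(Nat.cast_nonneg m : (0 : ℝ) ≤ m)]
  have hD0 := clauseConst_nonneg k hμ0
  have hD : expect (weight (n + 1) k b) (satInd (n := n + 1) (k := k) (m := m)) -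
      expect (weight (n + 1) k b) (satInd (n := n + 1) (k := k) (m := m + 1)) ≤
      clauseConst k μ / √((n + 1 : ℕ) : ℝ) := by
    refine (expect_satInd_sub_succ_le (μ := μ) hk1 (by omega) hb ?_ ?_).trans ?_
    · push_cast at hμ
      linarith
    · push_cast at hm
      have : (0 : ℝ) ≤ n := by positivity
      linarith
    · gcongr
      simp
  have hY := frozenMoment_pred_le hk1 hkn hb (frozenMoment_le hk1 hkn hb hD hD0)
  obtain ⟨t, ht, hle⟩ := exists_hasDerivAt_expect_satInd (m := m) hkn hb hb0
  refine ⟨t, ht, hle.trans ?_⟩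
  set N : ℝ := ((n + 1 : ℕ) : ℝ) with hN
  set r : ℝ := N ^ (-(((k : ℝ) - 1) / (2 * k))) with hr
  set A : ℝ := 1 + 2 ^ k * (clauseConst k μ + k ^ 2) with hA
  have hY0 : 0 ≤ frozenMoment (n + 1) k m b (k - 1) := frozenMoment_nonneg hb _
  have hr0 : 0 ≤ r := Real.rpow_nonneg hn.le _
  have hA0 : 0 ≤ A := by positivity
  -- Since `N ≥ 2 k + 1`, every factor of the falling factorial is at least `N / 2`.
  have hdf : (((n + 1).descFactorial k : ℕ) : ℝ)⁻¹ ≤ 2 ^ k / N ^ k := by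
    have h1 : (N / 2) ^ k ≤ ((n + 1).descFactorial k : ℝ) := by
      have h2 : (((n + 1 + 1 - k) ^ k : ℕ) : ℝ) ≤ ((n + 1).descFactorial k : ℝ) := by
        exact_mod_cast Nat.pow_sub_le_descFactorial (n + 1) k
      refine le_trans ?_ h2
      push_cast
      refine pow_le_pow_left₀ (by positivity) ?_ k
      have h3 : n + 1 ≤ 2 * (n + 1 + 1 - k) := by omega
      have h4 : N ≤ 2 * ((n + 1 + 1 - k : ℕ) : ℝ) := by
        rw [hN]
        exact_mod_cast h3
      linarith
    calc _ ≤ ((N / 2) ^ k)⁻¹ := inv_anti₀ (by positivity) h1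
      _ = _ := by rw [div_pow, inv_div]
  calc _ ≤ (m + 1) * (2 ^ k / N ^ k * k ^ 3 * (N ^ (k - 1) * (A * r))) := by gcongr
    _ ≤ (μ * N) * (2 ^ k / N ^ k * k ^ 3 * (N ^ (k - 1) * (A * r))) := by gcongr
    _ = _ := by
      have : N ^ k = N ^ (k - 1) * N := by rw [← pow_succ, Nat.sub_add_cancel hk1]
      rw [this]
      field_simp

end PolarizedSAT

theorem mainTheorem3 (k : ℕ) (hk : 2 ≤ k) :
    ∃ c : ℝ, (k : ℝ) ≤ c ∧
      ∀ n m : ℕ, c < (n : ℝ) → (m : ℝ) / (n : ℝ) ∈ Set.Icc (1 / 2 : ℝ) (2 ^ k) →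
        ∀ b ∈ Set.Icc (0 : ℝ) (1 / 2),
          DifferentiableWithinAt ℝ (PolarizedSAT.satProb n k m)
              (Set.Icc (-(1 / 2) : ℝ) (1 / 2)) b ∧
            derivWithin (PolarizedSAT.satProb n k m) (Set.Icc (-(1 / 2) : ℝ) (1 / 2)) b
              ≤ c * (n : ℝ) ^ (-(((k : ℝ) - 1) / (2 * (k : ℝ)))) := by
  set c₀ : ℝ := 2 ^ k * 2 ^ k * k ^ 3 *
    (1 + 2 ^ k * (PolarizedSAT.clauseConst k (2 ^ k) + k ^ 2)) with hc₀
  have hc₀0 : 0 ≤ c₀ := by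
    have := PolarizedSAT.clauseConst_nonneg k (μ := 2 ^ k) (by positivity)
    positivity
  -- The summand `2 * k` forces `n > 2 k`; `c₀` is the analytic constant for clause density at most
  -- `μ = 2 ^ k`.
  refine ⟨2 * k + c₀, by linarith [(Nat.cast_nonneg k : (0 : ℝ) ≤ k)], ?_⟩
  intro n m hn hm b hb
  have hkn : 2 * k < n := by
    have : (2 : ℝ) * k < n := by linarith
    exact_mod_cast this
  have hn0 : (0 : ℝ) < n := by
    have : 0 < n := by omega
    exact_mod_cast this
  rw [Set.mem_Icc, le_div_iff₀ hn0, div_le_iff₀ hn0] at hm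
  obtain ⟨m, rfl⟩ : ∃ l, m = l + 1 := by
    refine ⟨m - 1, ?_⟩
    have : (0 : ℝ) < m := by linarith
    have : 0 < m := by exact_mod_cast this
    omega
  push_cast at hm
  have hb' : b ∈ Set.Icc (-(1 / 2) : ℝ) (1 / 2) := ⟨by linarith [hb.1], hb.2⟩
  obtain ⟨t, ht, hle⟩ := PolarizedSAT.exists_hasDerivAt_expect_satInd_le (n := n) (k := k) (m := m)
    (μ := 2 ^ k) (by omega) (by omega) (abs_le.2 hb') hb.1 (by linarith [hm.1]) hm.2
  have ht' : HasDerivWithinAt (PolarizedSAT.satProb n k (m + 1)) t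
      (Set.Icc (-(1 / 2) : ℝ) (1 / 2)) b :=
    ht.hasDerivWithinAt.congr
      (fun x hx => PolarizedSAT.satProb_eq_expect n k (m + 1) (abs_le.2 hx))
      (PolarizedSAT.satProb_eq_expect n k (m + 1) (abs_le.2 hb'))
  refine ⟨ht'.differentiableWithinAt, ?_⟩
  rw [ht'.derivWithin (uniqueDiffOn_Icc (by norm_num) b hb')]
  refine hle.trans ?_
  gcongr
  have : (0 : ℝ) ≤ 2 * k := by positivity
  linarith
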